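/- Let $d\ge 2$, let $D\subset\mathbb R^d$ be a compact set with non-empty interior, and let $V_0>0$. For a compact set $K\subset\mathbb R^d$ let $\mathrm{cap}(K)$ be the infimum of $\int_{\mathbb R^d}\left(v^2+|\nabla v|^2\right)$ over all $v\in C_c^\infty(\mathbb R^d)$ with $v\ge 1$ on $K$. For an open set $\omega$ let $\mathrm{cap}(\omega)$ be the supremum of $\mathrm{cap}(K)$ over the compact sets $K\subset\omega$, and for an arbitrary set $A$ let $\mathrm{cap}(A)$ be the infimum of $\mathrm{cap}(\omega)$ over the open sets $\omega\supset A$. A set $\Omega\subset\mathbb R^d$ is quasi-open if there is a non-increasing sequence of open sets $(\omega_k)_{k\in\mathbb N}$ such that $\mathrm{cap}(\omega_k)\to 0$ and $\Omega\cup\omega_k$ is open for every $k$. For a quasi-open set $\Omega$, $W^{1,2}_0(\Omega)$ is the set of all $v\in W^{1,2}(\mathbb R^d)$ that vanish (in the sense of their quasi-continuous representatives) on $\mathbb R^d\setminus\Omega$ up to a set of zero capacity, and $W^{1,2}_0(\Omega;\mathbb R^d)$ is the set of vector fields all of whose coordinates belong to $W^{1,2}_0(\Omega)$. The first Dirichlet–Stokes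 eigenvalue of $\Omega$ is $$\lambda_1(\Omega)=\inf\left\{\frac{\int_\Omega\sum_{i,j=1}^d\left(\frac{\partial u_i}{\partial x_j}\right)^2}{\int_\Omega\sum_{i=1}^d u_i^2}\;:\; u\in W^{1,2}_0(\Omega;\mathbb R^d),\ \nabla\cdot u=0\text{ a.e. in }\Omega,\ u\ne 0\right\}\in[0,+\infty],\qquad \inf\emptyset=+\infty.$$ Let $\widehat{\mathscr O}_{V_0}$ be the class of the quasi-open sets $\Omega\subset D$ with $|\Omega|\le V_0$. Then the problem $$\inf_{\Omega\in\widehat{\mathscr O}_{V_0}}\lambda_1(\Omega)$$ has a solution: there is $\Omega^*\in\widehat{\mathscr O}_{V_0}$ such that $\lambda_1(\Omega^*)\le\lambda_1(\Omega)$ for every $\Omega\in\widehat{\mathscr O}_{V_0}$. Moreover $|\Omega^*|>0$, and $\lambda_1(\Omega^*)$ is finite and is attained: the infimum that defines it is a minimum. -/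

import Mathlib

open MeasureTheory Set Filter Topology
open scoped ContDiff ENNReal

namespace StokesBox

/-- The Euclidean space `ℝ^d`. -/
abbrev E (d : ℕ) : Type := EuclideanSpace ℝ (Fin d)

noncomputable section

/-! ## Capacity -/

/-- The smooth compactly supported functions that are at least `1` on `K`. -/
def capacityTests {d : ℕ} (K : Set (E d)) : Set (E d → ℝ) :=
  {φ | ContDiff ℝ ∞ φ ∧ HasCompactSupport φ ∧ ∀ x ∈ K, 1 ≤ φ x}

/-- The capacity of a compact set associated with the norm of `W^{1,2}(ℝ^d)`. The operator norm of
the differential is the Euclidean norm of the gradient. -/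
def compactCapacity {d : ℕ} (K : Set (E d)) : ℝ≥0∞ :=
  ⨅ φ ∈ capacityTests K, ENNReal.ofReal (∫ x, (φ x ^ 2 + ‖fderiv ℝ φ x‖ ^ 2))

/-- The capacity of an open set: the supremum of the capacities of its compact subsets. -/
def openCapacity {d : ℕ} (U : Set (E d)) : ℝ≥0∞ :=
  ⨆ (K : Set (E d)) (_ : IsCompact K) (_ : K ⊆ U), compactCapacity K

/-- The capacity of an arbitrary set, by outer regularity. -/
def capacity {d : ℕ} (A : Set (E d)) : ℝ≥0∞ :=
  ⨅ (U : Set (E d)) (_ : IsOpen U) (_ : A ⊆ U), openCapacity U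

theorem openCapacity_mono {d : ℕ} {A B : Set (E d)} (h : A ⊆ B) :
    openCapacity A ≤ openCapacity B :=
  iSup_mono fun _ => iSup_mono fun _ => iSup_le fun hK =>
    le_iSup_of_le (hK.trans h) le_rfl

/-- The two capacities agree on open sets. -/
theorem capacity_of_isOpen {d : ℕ} {U : Set (E d)} (h : IsOpen U) :
    capacity U = openCapacity U :=
  le_antisymm (iInf_le_of_le U (iInf_le_of_le h (iInf_le_of_le Subset.rfl le_rfl)))
    (le_iInf fun _ => le_iInf fun _ => le_iInf fun h' => openCapacity_mono h')

/-! ## Quasi-open sets and quasi-continuous functions -/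

/-- `U` is a non-increasing sequence of open sets whose capacities tend to `0`. -/
def IsVanishingSequence {d : ℕ} (U : ℕ → Set (E d)) : Prop :=
  Antitone U ∧ (∀ k, IsOpen (U k)) ∧ Tendsto (fun k => openCapacity (U k)) atTop (𝓝 0)

/-- Quasi-open subsets of `ℝ^d`. -/
def IsQuasiOpen {d : ℕ} (Ω : Set (E d)) : Prop :=
  ∃ U : ℕ → Set (E d), IsVanishingSequence U ∧ ∀ k, IsOpen (Ω ∪ U k)

/-- Quasi-continuous functions: continuous in restriction to the complements of open sets of
arbitrarily small capacity. -/
def IsQuasiContinuous {d : ℕ} (f : E d → ℝ) : Prop :=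
  ∃ U : ℕ → Set (E d), IsVanishingSequence U ∧ ∀ k, ContinuousOn f (U k)ᶜ

/-! ## Sobolev spaces -/

/-- `g` is the weak partial derivative `∂v/∂x_j` on `ℝ^d`. -/
def IsWeakPartial {d : ℕ} (j : Fin d) (v g : E d → ℝ) : Prop :=
  ∀ φ : E d → ℝ, ContDiff ℝ ∞ φ → HasCompactSupport φ →
    ∫ x, v x * fderiv ℝ φ x (EuclideanSpace.single j 1) = - ∫ x, g x * φ x

/-- The Sobolev space `W^{1,2}(ℝ^d)`. -/
def MemW12 {d : ℕ} (v : E d → ℝ) : Prop :=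
  MemLp v 2 volume ∧ ∀ j : Fin d, ∃ g : E d → ℝ, MemLp g 2 volume ∧ IsWeakPartial j v g

/-- The Sobolev space `W^{1,2}_0(Ω)`: the functions of `W^{1,2}(ℝ^d)` that vanish outside `Ω` up to
a set of zero capacity. As usual, a Sobolev function is evaluated up to sets of zero capacity by
means of its quasi-continuous representative. -/
def MemW12Zero {d : ℕ} (Ω : Set (E d)) (v : E d → ℝ) : Prop :=
  MemW12 v ∧ ∃ w : E d → ℝ, IsQuasiContinuous w ∧ v =ᵐ[volume] w ∧
    capacity {x | x ∉ Ω ∧ w x ≠ 0} = 0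

/-- `G = (∂u_i/∂x_j)` is the weak Jacobian matrix, with entries in `L²`, of the vector field `u`. -/
def IsWeakJacobian {d : ℕ} (u : E d → E d) (G : E d → Matrix (Fin d) (Fin d) ℝ) : Prop :=
  ∀ i j : Fin d, MemLp (fun x => G x i j) 2 volume ∧
    IsWeakPartial j (fun x => u x i) (fun x => G x i j)

/-! ## The first Dirichlet-Stokes eigenvalue -/

/-- `u` is a nonzero vector field in `W^{1,2}_0(Ω; ℝ^d)`, with weak Jacobian matrix `G`, and its
divergence vanishes in `Ω`. -/
structure IsStokesTest {d : ℕ} (Ω : Set (E d)) (u : E d → E d)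
    (G : E d → Matrix (Fin d) (Fin d) ℝ) : Prop where
  mem : ∀ i : Fin d, MemW12Zero Ω (fun x => u x i)
  jacobian : IsWeakJacobian u G
  div_eq_zero : ∀ᵐ x ∂(volume.restrict Ω), (G x).trace = 0
  ne_zero : ¬ u =ᵐ[volume] 0

/-- The Rayleigh quotient, with the squared Frobenius norm of the Jacobian matrix. -/
def rayleigh {d : ℕ} (Ω : Set (E d)) (u : E d → E d)
    (G : E d → Matrix (Fin d) (Fin d) ℝ) : ℝ :=
  (∫ x in Ω, ∑ i, ∑ j, G x i j ^ 2) / ∫ x in Ω, ‖u x‖ ^ 2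

/-- The first Dirichlet-Stokes eigenvalue of `Ω`; it is `+∞` if there is no test field. -/
def lambdaOne {d : ℕ} (Ω : Set (E d)) : EReal :=
  ⨅ (u : E d → E d) (G : E d → Matrix (Fin d) (Fin d) ℝ) (_ : IsStokesTest Ω u G),
    (rayleigh Ω u G : EReal)

/-- The quasi-open sets included in `D` whose volume is at most `V₀`. -/
def admissibleClass {d : ℕ} (D : Set (E d)) (V₀ : ℝ) : Set (Set (E d)) :=
  {Ω | IsQuasiOpen Ω ∧ Ω ⊆ D ∧ volume Ω ≤ ENNReal.ofReal V₀}

end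

end StokesBox

namespace StokesBox

noncomputable section

/-! ## Mollification in `L²` -/

open scoped Convolution

/-! The proof is the direct method, applied to pairs (set, field) instead of sets alone. Minimizing
`lambdaOne` over admissible sets amounts to minimizing the Rayleigh quotient over all admissible
sets and all their test fields, so it suffices to find one pair that attains this joint infimum. The
infimum is finite because a small open subset of D carries a rotated gradient of a bump function;
this is where d ≥ 2 enters.

A minimizing sequence of fields, normalized in L², is bounded in W^{1,2} and supported in the
compact set D. Along a subsequence the fields and the entries of their Jacobians converge weakly in
L² (`exists_common_subseq_weaklyTendsto`), and the fields converge strongly by Rellich's theorem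
(`tendsto_eLpNorm_sub_of_weaklyTendsto`). Hence the limit u has norm 1, its Dirichlet energy does
not exceed the infimum, and it is divergence-free, since this condition is linear.

No limit of the sets is taken: the optimal set is the set where a quasi-continuous representative of
u does not vanish (`exists_isQuasiOpen_support`). It is quasi-open and u belongs to its W^{1,2}_0 by
construction. Its volume is at most V₀ because, by almost everywhere convergence of a further
subsequence, almost each of its points lies in all the sets of that subsequence from some index on
(`volume_support_le`).

Two facts make this work. The gradient of a Sobolev function vanishes almost everywhere on its zero
set (`ae_eq_zero_of_isWeakPartial`), so the divergence condition and the integrals over Ω can be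
read on the whole space and no longer depend on Ω. Rapidly converging mollifications converge
uniformly outside open sets of small capacity (`exists_isVanishingSequence_of_energy_le`), which
produces the quasi-continuous representatives. -/

theorem eLpNorm_two_sq {α F : Type*} [MeasurableSpace α] [NormedAddCommGroup F] {μ : Measure α}
    (f : α → F) : eLpNorm f 2 μ ^ 2 = ∫⁻ x, ‖f x‖ₑ ^ 2 ∂μ := by
  have h := eLpNorm_nnreal_pow_eq_lintegral (p := 2) (f := f) (μ := μ) (by norm_num)
  have h2 : ((2 : NNReal) : ℝ) = (2 : ℕ) := by norm_num
  simpa only [h2, ENNReal.rpow_natCast, ENNReal.coe_ofNat] using h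

theorem eLpNorm_two_le_iff {α F : Type*} [MeasurableSpace α] [NormedAddCommGroup F]
    {μ : Measure α} {f : α → F} {C : ℝ≥0∞} :
    eLpNorm f 2 μ ≤ C ↔ ∫⁻ x, ‖f x‖ₑ ^ 2 ∂μ ≤ C ^ 2 := by
  rw [← eLpNorm_two_sq, ENNReal.pow_le_pow_left_iff two_ne_zero]

theorem lintegral_sq_le_of_isProbabilityMeasure {T : Type*} [MeasurableSpace T] {ν : Measure T}
    [IsProbabilityMeasure ν] {f : T → ℝ≥0∞} (hf : AEMeasurable f ν) :
    (∫⁻ t, f t ∂ν) ^ 2 ≤ ∫⁻ t, f t ^ 2 ∂ν := by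
  have h := ENNReal.lintegral_mul_le_Lp_mul_Lq ν Real.HolderConjugate.two_two hf
    (aemeasurable_const (b := (1 : ℝ≥0∞)))
  simp only [Pi.mul_apply, mul_one, ENNReal.rpow_two, one_pow, lintegral_one, measure_univ,
    ENNReal.one_rpow] at h
  calc _ ≤ ((∫⁻ t, f t ^ 2 ∂ν) ^ (1 / 2 : ℝ)) ^ 2 := by gcongr
    _ = _ := by
      rw [← ENNReal.rpow_natCast, ← ENNReal.rpow_mul]; norm_num

/-- A form of Minkowski's integral inequality. -/
theorem eLpNorm_two_le_of_le_lintegral {α T : Type*} [MeasurableSpace α] [MeasurableSpace T]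
    {μ : Measure α} [SFinite μ] {ν : Measure T} [IsProbabilityMeasure ν] {A : α → ℝ}
    {F : α → T → ℝ≥0∞} {C : ℝ≥0∞} (hF : AEMeasurable (Function.uncurry F) (μ.prod ν))
    (hA : ∀ᵐ x ∂μ, ‖A x‖ₑ ≤ ∫⁻ t, F x t ∂ν) (hC : ∀ᵐ t ∂ν, ∫⁻ x, F x t ^ 2 ∂μ ≤ C ^ 2) :
    eLpNorm A 2 μ ≤ C := by
  rw [eLpNorm_two_le_iff]
  calc ∫⁻ x, ‖A x‖ₑ ^ 2 ∂μ ≤ ∫⁻ x, ∫⁻ t, F x t ^ 2 ∂ν ∂μ := by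
        refine lintegral_mono_ae ?_
        have h2 : ∀ᵐ x ∂μ, AEMeasurable (F x) ν := by
          obtain ⟨g, hg, hFg⟩ := hF
          filter_upwards [Measure.ae_ae_of_ae_prod hFg] with x hx
          exact ⟨fun t => g (x, t), hg.comp measurable_prodMk_left, hx⟩
        filter_upwards [hA, h2] with x hx hm
        calc _ ≤ (∫⁻ t, F x t ∂ν) ^ 2 := by gcongr
          _ ≤ _ := lintegral_sq_le_of_isProbabilityMeasure hm
    _ = ∫⁻ t, ∫⁻ x, F x t ^ 2 ∂μ ∂ν := lintegral_lintegral_swap (hF.pow_const 2)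
    _ ≤ ∫⁻ _, C ^ 2 ∂ν := lintegral_mono_ae hC
    _ = C ^ 2 := by simp

variable {d : ℕ}

/-- The mollification of a function by a normalized bump function. -/
def mollify (φ : ContDiffBump (0 : E d)) (f : E d → ℝ) : E d → ℝ :=
  φ.normed volume ⋆[ContinuousLinearMap.lsmul ℝ ℝ, volume] f

theorem mollify_apply (φ : ContDiffBump (0 : E d)) (f : E d → ℝ) (x : E d) :
    mollify φ f x = ∫ t, φ.normed volume t * f (x - t) := rfl

theorem mollify_apply' (φ : ContDiffBump (0 : E d)) (f : E d → ℝ) (x : E d) :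
    mollify φ f x = ∫ t, φ.normed volume (x - t) * f t :=
  convolution_lsmul_swap

theorem _root_.MeasureTheory.MemLp.locallyIntegrable_two {f : E d → ℝ} (hf : MemLp f 2 volume) :
    LocallyIntegrable f volume := hf.locallyIntegrable (by norm_num)

theorem convolutionExists_mollify (φ : ContDiffBump (0 : E d)) {f : E d → ℝ}
    (hf : LocallyIntegrable f volume) :
    ConvolutionExists (φ.normed volume) f (ContinuousLinearMap.lsmul ℝ ℝ) volume :=
  φ.hasCompactSupport_normed.convolutionExists_left _ φ.continuous_normed hf

theorem contDiff_mollify (φ : ContDiffBump (0 : E d)) {f : E d → ℝ}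
    (hf : LocallyIntegrable f volume) : ContDiff ℝ ∞ (mollify φ f) :=
  φ.hasCompactSupport_normed.contDiff_convolution_left _ φ.contDiff_normed hf

/-- The normalized bump is a probability density carried by the ball of radius `φ.rOut`, and the
mollification error is the average of the translation errors f(x - y) - f(x) against it. Minkowski's
inequality then bounds the average by a common bound of the terms. -/
theorem eLpNorm_mollify_sub_le (φ : ContDiffBump (0 : E d)) {f : E d → ℝ}
    (hf : MemLp f 2 volume) {C : ℝ≥0∞}
    (hC : ∀ y : E d, ‖y‖ < φ.rOut → eLpNorm (fun x => f (x - y) - f x) 2 volume ≤ C) :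
    eLpNorm (fun x => mollify φ f x - f x) 2 volume ≤ C := by
  set ρ : E d → ℝ := φ.normed volume with hρ
  have hρm : Measurable fun t => ENNReal.ofReal (ρ t) :=
    φ.continuous_normed.measurable.ennreal_ofReal
  set ν : Measure (E d) := volume.withDensity fun t => ENNReal.ofReal (ρ t) with hν
  have hprob : IsProbabilityMeasure ν := by
    constructor
    rw [hν, withDensity_apply _ MeasurableSet.univ, Measure.restrict_univ,
      ← ofReal_integral_eq_lintegral_ofReal φ.integrable_normed
        (Eventually.of_forall φ.nonneg_normed), φ.integral_normed, ENNReal.ofReal_one]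
  have hac : ν ≪ volume := withDensity_absolutelyContinuous _ _
  have hmeas : AEStronglyMeasurable (fun p : E d × E d => f (p.1 - p.2) - f p.1)
      (volume.prod volume) := by
    refine AEStronglyMeasurable.sub ?_ ?_
    · exact hf.1.comp_quasiMeasurePreserving
        (quasiMeasurePreserving_sub_of_right_invariant volume volume)
    · exact hf.1.comp_fst
  refine eLpNorm_two_le_of_le_lintegral (ν := ν) (F := fun x y => ‖f (x - y) - f x‖ₑ)
    ?_ ?_ ?_
  · exact (hmeas.mono_ac (Measure.AbsolutelyContinuous.rfl.prod hac)).enorm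
  · refine Eventually.of_forall fun x => ?_
    have hx : mollify φ f x - f x = ∫ t, ρ t * (f (x - t) - f x) := by
      have h1 : Integrable (fun t => ρ t * f (x - t)) volume :=
        convolutionExists_mollify φ hf.locallyIntegrable_two x
      have h2 : Integrable (fun t => ρ t * f x) volume := φ.integrable_normed.mul_const _
      simp only [mul_sub]
      rw [integral_sub h1 h2, integral_mul_const, φ.integral_normed, one_mul, mollify_apply]
    rw [hx]
    refine (enorm_integral_le_lintegral_enorm _).trans ?_
    rw [hν, lintegral_withDensity_eq_lintegral_mul_non_measurable₀ _ hρm.aemeasurable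
      (by simp)]
    refine lintegral_mono fun t => ?_
    simp only [Pi.mul_apply, enorm_mul]
    rw [Real.enorm_of_nonneg (φ.nonneg_normed t)]
  · have hsupp : ∀ᵐ t ∂ν, ‖t‖ < φ.rOut := by
      rw [hν, ae_withDensity_iff hρm]
      refine Eventually.of_forall fun t ht => ?_
      have : t ∈ Function.support (φ.normed volume) := by
        intro h0
        simp [hρ, h0] at ht
      rwa [φ.support_normed_eq, mem_ball_zero_iff] at this
    filter_upwards [hsupp] with t ht
    have := hC t ht
    rwa [eLpNorm_two_le_iff] at this

/-- Translations act continuously on L² because the exponent is finite. -/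
theorem exists_forall_eLpNorm_translate_sub_le {f : E d → ℝ} (hf : MemLp f 2 volume)
    {ε : ℝ≥0∞} (hε : 0 < ε) :
    ∃ δ > 0, ∀ y : E d, ‖y‖ < δ → eLpNorm (fun x => f (x - y) - f x) 2 volume ≤ ε := by
  have : Fact ((2 : ℝ≥0∞) ≠ ⊤) := ⟨by norm_num⟩
  let F : E d → Lp ℝ 2 (volume : Measure (E d)) := fun y => DomAddAct.mk (-y) +ᵥ hf.toLp f
  have hc : Continuous F := by
    have h1 : Continuous fun y : E d => (DomAddAct.mk (-y) : (E d)ᵈᵃᵃ) :=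
      DomAddAct.continuous_mk.comp continuous_neg
    exact h1.vadd continuous_const
  have h0 := hc.tendsto 0
  have h0' : Tendsto (fun y => edist (F y) (F 0)) (𝓝 0) (𝓝 0) := by
    simpa using (h0.edist (tendsto_const_nhds (x := F 0)))
  have hev := (ENNReal.tendsto_nhds_zero.1 h0') ε hε
  obtain ⟨δ, hδ, hb⟩ := Metric.eventually_nhds_iff.1 hev
  refine ⟨δ, hδ, fun y hy => ?_⟩
  have h := hb (y := y) (by simpa using hy)
  have e0 : F 0 = hf.toLp f := by simp [F]
  have e1 : F y = (hf.comp_measurePreserving (measurePreserving_vadd (-y) volume)).toLp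
      (f <| (-y) +ᵥ ·) := DomAddAct.mk_vadd_toLp _ hf
  rw [e0, e1, Lp.edist_toLp_toLp] at h
  refine le_trans (le_of_eq ?_) h
  refine congrArg (fun g => eLpNorm g 2 volume) ?_
  funext x
  simp [sub_eq_neg_add]

theorem tendsto_eLpNorm_mollify_sub {ι : Type*} {l : Filter ι} {φ : ι → ContDiffBump (0 : E d)}
    (hφ : Tendsto (fun i => (φ i).rOut) l (𝓝 0)) {f : E d → ℝ} (hf : MemLp f 2 volume) :
    Tendsto (fun i => eLpNorm (fun x => mollify (φ i) f x - f x) 2 volume) l (𝓝 0) := by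
  rw [ENNReal.tendsto_nhds_zero]
  intro ε hε
  obtain ⟨δ, hδ, h⟩ := exists_forall_eLpNorm_translate_sub_le hf hε
  filter_upwards [hφ.eventually (gt_mem_nhds hδ)] with i hi
  exact eLpNorm_mollify_sub_le _ hf fun y hy => h y (hy.trans hi)

/-- Each translation error has norm at most twice that of f, hence so does the mollification error;
adding f back gives the claim without Young's inequality. -/
theorem memLp_mollify (φ : ContDiffBump (0 : E d)) {f : E d → ℝ} (hf : MemLp f 2 volume) :
    MemLp (mollify φ f) 2 volume := by
  have hs : AEStronglyMeasurable (mollify φ f) volume :=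
    (contDiff_mollify φ hf.locallyIntegrable_two).continuous.aestronglyMeasurable
  have h : MemLp (fun x => mollify φ f x - f x) 2 volume := by
    refine ⟨hs.sub hf.1, ?_⟩
    refine (eLpNorm_mollify_sub_le φ hf (C := eLpNorm f 2 volume + eLpNorm f 2 volume)
      fun y _ => ?_).trans_lt (ENNReal.add_lt_top.2 ⟨hf.2, hf.2⟩)
    have hmp := measurePreserving_sub_right (volume : Measure (E d)) y
    have hfy : MemLp (fun x => f (x - y)) 2 volume := hf.comp_measurePreserving hmp
    refine (eLpNorm_sub_le hfy.1 hf.1 (by norm_num)).trans ?_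
    gcongr
    exact (eLpNorm_comp_measurePreserving hf.1 hmp).le
  simpa [Pi.add_def] using h.add hf

/-- The derivative falls on the kernel, and t ↦ ρ(x - t) is itself a test function for the weak
derivative. The sign from the reflection cancels the sign from the integration by parts. -/
theorem fderiv_mollify (φ : ContDiffBump (0 : E d)) {j : Fin d} {v g : E d → ℝ}
    (hv : LocallyIntegrable v volume) (hg : IsWeakPartial j v g) (x : E d) :
    fderiv ℝ (mollify φ v) x (EuclideanSpace.single j 1) = mollify φ g x := by
  have hρ : ContDiff ℝ ∞ (φ.normed (volume : Measure (E d))) := φ.contDiff_normed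
  have hd := φ.hasCompactSupport_normed.hasFDerivAt_convolution_left
    (ContinuousLinearMap.lsmul ℝ ℝ) (μ := volume) (hρ.of_le (by exact_mod_cast le_top)) hv x
  have hex := (φ.hasCompactSupport_normed (μ := volume)).fderiv (𝕜 := ℝ)
    |>.convolutionExists_left
    ((ContinuousLinearMap.lsmul ℝ ℝ).precompL (E d)) (hρ.continuous_fderiv (by simp)) hv x
  rw [mollify, hd.fderiv, convolution_eq_swap, ContinuousLinearMap.integral_apply]
  swap
  · exact (convolutionExistsAt_iff_integrable_swap).1 hex
  set ψ : E d → ℝ := fun t => φ.normed volume (x - t) with hψ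
  have hψs : ContDiff ℝ ∞ ψ := hρ.comp (contDiff_const.sub contDiff_id)
  have hψc : HasCompactSupport ψ :=
    φ.hasCompactSupport_normed.comp_homeomorph (Homeomorph.subLeft x)
  have hψd : ∀ t w, fderiv ℝ ψ t w = - fderiv ℝ (φ.normed volume) (x - t) w := by
    intro t w
    have h1 : HasFDerivAt ψ ((fderiv ℝ (φ.normed volume) (x - t)).comp
        (-ContinuousLinearMap.id ℝ (E d))) t := by
      refine HasFDerivAt.comp t
        ((hρ.differentiable (by simp)).differentiableAt.hasFDerivAt) ?_
      exact (hasFDerivAt_id t).const_sub x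
    rw [h1.fderiv]; simp
  have hw := hg ψ hψs hψc
  rw [mollify_apply']
  simp only [ContinuousLinearMap.precompL_apply, ContinuousLinearMap.lsmul_apply, smul_eq_mul]
  calc _ = - ∫ t, v t * fderiv ℝ ψ t (EuclideanSpace.single j 1) := by
        rw [← integral_neg]
        refine integral_congr_ae (Eventually.of_forall fun t => ?_)
        simp only [hψd]; ring
    _ = ∫ t, g t * ψ t := by rw [hw, neg_neg]
    _ = _ := by simp only [hψ, mul_comm]

/-- A sequence of bump functions whose supports shrink to the origin. -/
def shrinkingBump (n : ℕ) : ContDiffBump (0 : E d) where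
  rIn := 1 / (n + 1 : ℝ) / 2
  rOut := 1 / (n + 1 : ℝ)
  rIn_pos := by positivity
  rIn_lt_rOut := half_lt_self (by positivity)

theorem tendsto_rOut_shrinkingBump :
    Tendsto (fun n => (shrinkingBump n : ContDiffBump (0 : E d)).rOut) atTop (𝓝 0) :=
  tendsto_one_div_add_atTop_nhds_zero_nat

/-! ### Translation estimates in L². -/

theorem eLpNorm_comp_sub_right {f : E d → ℝ} (hf : AEStronglyMeasurable f volume) (y : E d) :
    eLpNorm (fun x => f (x - y)) 2 volume = eLpNorm f 2 volume :=
  eLpNorm_comp_measurePreserving hf (measurePreserving_sub_right volume y)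

theorem eq_sum_coord_smul_single (y : E d) :
    y = ∑ j, y j • EuclideanSpace.single j (1 : ℝ) := by
  ext i
  simp [Pi.single_apply]

/-- Translations of a continuously differentiable function. -/
theorem eLpNorm_translate_sub_le_of_contDiff {φ : E d → ℝ} (hφ : ContDiff ℝ 1 φ) (y : E d) :
    eLpNorm (fun x => φ (x - y) - φ x) 2 volume ≤
      ‖y‖ₑ * ∑ j, eLpNorm (fun x => fderiv ℝ φ x (EuclideanSpace.single j 1)) 2 volume := by
  have hcd : Continuous (fderiv ℝ φ) := hφ.continuous_fderiv one_ne_zero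
  have : IsProbabilityMeasure (volume.restrict (Ioc (0 : ℝ) 1)) := ⟨by simp⟩
  have hcont : Continuous fun p : E d × ℝ => fderiv ℝ φ (p.1 - p.2 • y) y := by fun_prop
  -- The difference φ(x - y) - φ(x) is an integral over t in (0, 1] of directional derivatives at x
  -- - ty. Lebesgue measure on this interval is a probability measure, so Minkowski's inequality
  -- applies, and translation invariance removes t.
  refine eLpNorm_two_le_of_le_lintegral (ν := volume.restrict (Ioc (0 : ℝ) 1))
    (F := fun x t => ‖fderiv ℝ φ (x - t • y) y‖ₑ) ?_ ?_ ?_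
  · exact hcont.enorm.measurable.aemeasurable
  · refine Eventually.of_forall fun x => ?_
    have hder : ∀ t ∈ uIcc (0 : ℝ) 1, HasDerivAt (fun t : ℝ => φ (x - t • y))
        (-(fderiv ℝ φ (x - t • y) y)) t := by
      intro t _
      have h1 : HasDerivAt (fun t : ℝ => x - t • y) (-y) t := by
        simpa using ((hasDerivAt_id t).smul_const y).const_sub x
      have h2 := ((hφ.differentiable one_ne_zero).differentiableAt
        (x := x - t • y)).hasFDerivAt.comp_hasDerivAt t h1
      exact h2.congr_deriv (by simp)
    have hint : IntervalIntegrable (fun t : ℝ => -(fderiv ℝ φ (x - t • y) y)) volume 0 1 :=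
      Continuous.intervalIntegrable (by fun_prop) _ _
    have hftc := intervalIntegral.integral_eq_sub_of_hasDerivAt hder hint
    simp only [one_smul, zero_smul, sub_zero] at hftc
    rw [← hftc, intervalIntegral.integral_of_le zero_le_one]
    refine (enorm_integral_le_lintegral_enorm _).trans (le_of_eq ?_)
    simp
  · refine Eventually.of_forall fun t => ?_
    rw [← eLpNorm_two_le_iff]
    have hm : AEStronglyMeasurable (fun x => fderiv ℝ φ x y) volume :=
      Continuous.aestronglyMeasurable (by fun_prop)
    rw [eLpNorm_comp_sub_right hm (t • y)]
    have hexp : (fun x => fderiv ℝ φ x y) =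
        ∑ j, (y j) • fun x => fderiv ℝ φ x (EuclideanSpace.single j 1) := by
      funext x
      conv_lhs => rw [eq_sum_coord_smul_single y]
      simp
    rw [hexp, Finset.mul_sum]
    refine (eLpNorm_sum_le (fun j _ => ?_) (by norm_num)).trans (Finset.sum_le_sum fun j _ => ?_)
    · refine AEStronglyMeasurable.const_smul (Continuous.aestronglyMeasurable ?_) _
      fun_prop
    · rw [eLpNorm_const_smul]
      gcongr
      exact enorm_le_iff_norm_le.2 (PiLp.norm_apply_le y j)

/-- Translations of a Sobolev function. -/
theorem eLpNorm_translate_sub_le {v : E d → ℝ} {g : Fin d → E d → ℝ} (hv : MemLp v 2 volume)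
    (hg : ∀ j, MemLp (g j) 2 volume) (hvg : ∀ j, IsWeakPartial j v (g j)) (y : E d) :
    eLpNorm (fun x => v (x - y) - v x) 2 volume ≤ ‖y‖ₑ * ∑ j, eLpNorm (g j) 2 volume := by
  set b : ℕ → ContDiffBump (0 : E d) := fun n => shrinkingBump n
  have hb : Tendsto (fun n => (b n).rOut) atTop (𝓝 0) := tendsto_rOut_shrinkingBump
  -- The smooth estimate is applied to the mollification of v, whose derivatives are the
  -- mollifications of the g j; the errors disappear as n tends to infinity.
  have hbound : ∀ n, eLpNorm (fun x => v (x - y) - v x) 2 volume ≤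
      eLpNorm (fun x => mollify (b n) v x - v x) 2 volume +
      eLpNorm (fun x => mollify (b n) v x - v x) 2 volume +
      ‖y‖ₑ * ∑ j, (eLpNorm (fun x => mollify (b n) (g j) x - g j x) 2 volume +
        eLpNorm (g j) 2 volume) := by
    intro n
    have hm := memLp_mollify (b n) hv
    have hs := contDiff_mollify (b n) hv.locallyIntegrable_two
    have hd : MemLp (fun x => mollify (b n) v x - v x) 2 volume := hm.sub hv
    have hdm := hd.1.comp_measurePreserving (measurePreserving_sub_right volume y)
    have hmm := hm.1.comp_measurePreserving (measurePreserving_sub_right volume y)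
    have e : (fun x => v (x - y) - v x) =
        ((fun x => mollify (b n) v x - v x) -
        (fun x => mollify (b n) v (x - y) - v (x - y))) +
        fun x => mollify (b n) v (x - y) - mollify (b n) v x := by
      funext x; simp only [Pi.add_apply, Pi.sub_apply]; ring
    rw [e]
    refine (eLpNorm_add_le (hd.1.sub hdm) (hmm.sub hm.1) (by norm_num)).trans ?_
    refine add_le_add ((eLpNorm_sub_le hd.1 hdm (by norm_num)).trans ?_) ?_
    · rw [show (fun x => mollify (b n) v x - v x) ∘ (fun x => x - y) =
        fun x => (fun x => mollify (b n) v x - v x) (x - y) from rfl,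
        eLpNorm_comp_sub_right hd.1 y]
    · refine (eLpNorm_translate_sub_le_of_contDiff (hs.of_le (by exact_mod_cast le_top)) y).trans ?_
      gcongr with j
      simp only [fderiv_mollify (b n) hv.locallyIntegrable_two (hvg j)]
      have hgd : MemLp (fun x => mollify (b n) (g j) x - g j x) 2 volume :=
        (memLp_mollify (b n) (hg j)).sub (hg j)
      have e : mollify (b n) (g j) = (fun x => mollify (b n) (g j) x - g j x) + g j := by
        funext x; simp
      conv_lhs => rw [show (fun x => mollify (b n) (g j) x) = mollify (b n) (g j) from rfl, e]
      exact eLpNorm_add_le hgd.1 (hg j).1 (by norm_num)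
  have hlim : Tendsto (fun n => eLpNorm (fun x => mollify (b n) v x - v x) 2 volume +
      eLpNorm (fun x => mollify (b n) v x - v x) 2 volume +
      ‖y‖ₑ * ∑ j, (eLpNorm (fun x => mollify (b n) (g j) x - g j x) 2 volume +
        eLpNorm (g j) 2 volume)) atTop
      (𝓝 (0 + 0 + ‖y‖ₑ * ∑ j, (0 + eLpNorm (g j) 2 volume))) := by
    have h1 := tendsto_eLpNorm_mollify_sub hb hv
    refine (h1.add h1).add (ENNReal.Tendsto.const_mul ?_ (Or.inr enorm_ne_top))
    refine tendsto_finsetSum _ fun j _ => ?_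
    exact (tendsto_eLpNorm_mollify_sub hb (hg j)).add tendsto_const_nhds
  simpa using ge_of_tendsto' hlim hbound

/-! ## The gradient vanishes on the zero set -/

/-- Cauchy–Schwarz, in the shape needed for errors that are sums of two products, each with one
factor small in L². -/
theorem enorm_integral_le_of_abs_le {α : Type*} [MeasurableSpace α] {μ : Measure α}
    {c a b a' b' : α → ℝ} (ha : AEStronglyMeasurable a μ) (hb : AEStronglyMeasurable b μ)
    (ha' : AEStronglyMeasurable a' μ) (hb' : AEStronglyMeasurable b' μ)
    (h : ∀ x, |c x| ≤ |a x| * |b x| + |a' x| * |b' x|) :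
    ‖∫ x, c x ∂μ‖ₑ ≤ eLpNorm a 2 μ * eLpNorm b 2 μ + eLpNorm a' 2 μ * eLpNorm b' 2 μ := by
  have key : ∀ {a b : α → ℝ}, AEStronglyMeasurable a μ → AEStronglyMeasurable b μ →
      ∫⁻ x, ‖a x‖ₑ * ‖b x‖ₑ ∂μ ≤ eLpNorm a 2 μ * eLpNorm b 2 μ := by
    intro a b ha hb
    have := eLpNorm_smul_le_mul_eLpNorm (p := 2) (q := 2) (r := 1) hb ha
    rw [eLpNorm_one_eq_lintegral_enorm] at this
    simpa [enorm_mul] using this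
  refine (enorm_integral_le_lintegral_enorm _).trans ?_
  calc ∫⁻ x, ‖c x‖ₑ ∂μ ≤ ∫⁻ x, (‖a x‖ₑ * ‖b x‖ₑ + ‖a' x‖ₑ * ‖b' x‖ₑ) ∂μ := by
        refine lintegral_mono fun x => ?_
        have := ENNReal.ofReal_le_ofReal (h x)
        rw [ENNReal.ofReal_add (by positivity) (by positivity),
          ENNReal.ofReal_mul (by positivity), ENNReal.ofReal_mul (by positivity)] at this
        simpa only [← Real.norm_eq_abs, ofReal_norm] using this
    _ = (∫⁻ x, ‖a x‖ₑ * ‖b x‖ₑ ∂μ) + ∫⁻ x, ‖a' x‖ₑ * ‖b' x‖ₑ ∂μ :=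
        lintegral_add_left' (ha.enorm.mul hb.enorm) _
    _ ≤ _ := add_le_add (key ha hb) (key ha' hb')

/-- Integration by parts for smooth functions. -/
theorem isWeakPartial_fderiv {f : E d → ℝ} (hf : ContDiff ℝ 1 f) (j : Fin d) :
    IsWeakPartial j f fun x => fderiv ℝ f x (EuclideanSpace.single j 1) := by
  intro φ hφ hφc
  have hcf := hf.continuous_fderiv one_ne_zero
  have hcφ := hφ.continuous_fderiv (by simp)
  have hc1 : Continuous fun x => fderiv ℝ f x (EuclideanSpace.single j 1) := by fun_prop
  have hc2 : Continuous fun x => fderiv ℝ φ x (EuclideanSpace.single j 1) := by fun_prop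
  refine integral_mul_fderiv_eq_neg_fderiv_mul_of_integrable ?_ ?_ ?_
    (fun x _ => hf.differentiable one_ne_zero x) (fun x _ => hφ.differentiable (by simp) x)
  · exact (hc1.mul hφ.continuous).integrable_of_hasCompactSupport hφc.mul_left
  · exact (hf.continuous.mul hc2).integrable_of_hasCompactSupport
      ((hφc.fderiv_apply ℝ _).mul_left)
  · exact (hf.continuous.mul hφ.continuous).integrable_of_hasCompactSupport hφc.mul_left

theorem abs_inv_one_add_sq_sub_le (s t : ℝ) :
    |(1 + s ^ 2)⁻¹ - (1 + t ^ 2)⁻¹| ≤ |s - t| := by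
  have hs : 0 < 1 + s ^ 2 := by positivity
  have ht : 0 < 1 + t ^ 2 := by positivity
  have e : (1 + s ^ 2)⁻¹ - (1 + t ^ 2)⁻¹ =
      (s - t) * (-(s + t) / ((1 + s ^ 2) * (1 + t ^ 2))) := by
    field_simp; ring
  rw [e, abs_mul]
  refine mul_le_of_le_one_right (abs_nonneg _) ?_
  rw [abs_div, abs_neg, abs_of_pos (mul_pos hs ht), div_le_one (mul_pos hs ht), abs_le]
  constructor <;> nlinarith [sq_nonneg (s - 1), sq_nonneg (t - 1), sq_nonneg (s + 1),
    sq_nonneg (t + 1), sq_nonneg (s * t)]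

theorem abs_arctan_sub_le (s t : ℝ) : |Real.arctan s - Real.arctan t| ≤ |s - t| := by
  have h : LipschitzWith 1 Real.arctan := by
    refine lipschitzWith_of_nnnorm_deriv_le Real.differentiable_arctan fun x => ?_
    rw [Real.deriv_arctan, ← NNReal.coe_le_coe, coe_nnnorm, Real.norm_eq_abs,
      abs_of_nonneg (by positivity), NNReal.coe_one, div_le_one (by positivity)]
    nlinarith [sq_nonneg x]
  simpa [Real.dist_eq] using h.dist_le_mul s t

theorem tendsto_integral_of_enorm_sub_le {α : Type*} [MeasurableSpace α] {μ : Measure α}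
    {X : ℕ → α → ℝ} {Y : α → ℝ} (hX : ∀ n, Integrable (X n) μ) (hY : Integrable Y μ)
    {c : ℕ → ℝ≥0∞} (hc : Tendsto c atTop (𝓝 0))
    (h : ∀ n, ‖∫ x, (X n x - Y x) ∂μ‖ₑ ≤ c n) :
    Tendsto (fun n => ∫ x, X n x ∂μ) atTop (𝓝 (∫ x, Y x ∂μ)) := by
  rw [tendsto_iff_edist_tendsto_0]
  refine tendsto_of_tendsto_of_tendsto_of_le_of_le tendsto_const_nhds hc (fun _ => zero_le)
    fun n => ?_
  rw [edist_eq_enorm_sub, ← integral_sub (hX n) hY]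
  exact h n

/-- The chain rule for `t ↦ arctan (k t)`. -/
theorem isWeakPartial_arctan {v g : E d → ℝ} {j : Fin d} (hv : MemLp v 2 volume)
    (hg : MemLp g 2 volume) (hvg : IsWeakPartial j v g) {k : ℝ} (hk : 0 < k) :
    IsWeakPartial j (fun x => Real.arctan (k * v x))
      fun x => (1 + (k * v x) ^ 2)⁻¹ * (k * g x) := by
  intro φ hφ hφc
  set b : ℕ → ContDiffBump (0 : E d) := fun n => shrinkingBump n
  have hb : Tendsto (fun n => (b n).rOut) atTop (𝓝 0) := tendsto_rOut_shrinkingBump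
  have hs : ∀ n, ContDiff ℝ ∞ (mollify (b n) v) := fun n =>
    contDiff_mollify (b n) hv.locallyIntegrable_two
  have hgc : ∀ n, Continuous (mollify (b n) g) := fun n =>
    (contDiff_mollify (b n) hg.locallyIntegrable_two).continuous
  set e : E d := EuclideanSpace.single j 1
  have hcφ : Continuous (fderiv ℝ φ) := hφ.continuous_fderiv (by simp)
  have hφ' : Continuous fun x => fderiv ℝ φ x e := by fun_prop
  have hφ'c : HasCompactSupport fun x => fderiv ℝ φ x e := hφc.fderiv_apply ℝ _
  have hφL : MemLp φ 2 volume := hφ.continuous.memLp_of_hasCompactSupport hφc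
  have hφL' : MemLp (fun x => fderiv ℝ φ x e) 2 volume := hφ'.memLp_of_hasCompactSupport hφ'c
  obtain ⟨M, hM⟩ := hφ.continuous.bounded_above_of_compact_support hφc
  have hdv : ∀ n, MemLp (fun x => mollify (b n) v x - v x) 2 volume := fun n =>
    (memLp_mollify _ hv).sub hv
  have hdg : ∀ n, MemLp (fun x => mollify (b n) g x - g x) 2 volume := fun n =>
    (memLp_mollify _ hg).sub hg
  -- For mollifications the chain rule is classical; both sides are then passed to the limit by L²
  -- convergence.
  have happ : ∀ n, ∫ x, Real.arctan (k * mollify (b n) v x) * fderiv ℝ φ x e =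
      -∫ x, ((1 + (k * mollify (b n) v x) ^ 2)⁻¹ * (k * mollify (b n) g x)) * φ x := by
    intro n
    have hcd : ContDiff ℝ 1 fun x => Real.arctan (k * mollify (b n) v x) :=
      (contDiff_const.mul ((hs n).of_le (by exact_mod_cast le_top))).arctan
    have := isWeakPartial_fderiv hcd j φ hφ hφc
    rw [this]
    congr 1
    refine integral_congr_ae (Eventually.of_forall fun x => ?_)
    have hd : HasFDerivAt (mollify (b n) v) (fderiv ℝ (mollify (b n) v) x) x :=
      ((hs n).differentiable (by simp) x).hasFDerivAt
    have := ((hd.const_mul k).arctan).fderiv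
    simp only [this]
    simp only [_root_.smul_apply, smul_eq_mul,
      fderiv_mollify (b n) hv.locallyIntegrable_two hvg, one_div]
  have hmv : AEStronglyMeasurable (fun x => k * v x) volume := hv.1.const_mul k
  have hat : AEStronglyMeasurable (fun x => Real.arctan (k * v x)) volume :=
    Real.continuous_arctan.comp_aestronglyMeasurable hmv
  have hh : AEStronglyMeasurable (fun x => (1 + (k * v x) ^ 2)⁻¹) volume :=
    (Continuous.inv₀ (by fun_prop) (fun t : ℝ => by positivity) :
      Continuous fun t : ℝ => (1 + t ^ 2)⁻¹).comp_aestronglyMeasurable hmv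
  have hhle : ∀ t : ℝ, |(1 + t ^ 2)⁻¹| ≤ 1 := fun t => by
    rw [abs_of_nonneg (by positivity)]
    exact inv_le_one_of_one_le₀ (by nlinarith [sq_nonneg t])
  have hinvc : ∀ n, Continuous fun x => (1 + (k * mollify (b n) v x) ^ 2)⁻¹ := fun n =>
    Continuous.inv₀ (by have := (hs n).continuous; fun_prop) fun t => by positivity
  have hL : Tendsto (fun n => ∫ x, Real.arctan (k * mollify (b n) v x) * fderiv ℝ φ x e) atTop
      (𝓝 (∫ x, Real.arctan (k * v x) * fderiv ℝ φ x e)) := by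
    refine tendsto_integral_of_enorm_sub_le (fun n => ?_) ?_
      (c := fun n => eLpNorm (fun x => mollify (b n) v x - v x) 2 volume *
        eLpNorm (fun x => k * fderiv ℝ φ x e) 2 volume + eLpNorm (fun _ : E d => (0 : ℝ)) 2 volume *
        eLpNorm (fun _ : E d => (0 : ℝ)) 2 volume) ?_ fun n => ?_
    · refine Continuous.integrable_of_hasCompactSupport ?_ hφ'c.mul_left
      exact (Real.continuous_arctan.comp (continuous_const.mul (hs n).continuous)).mul hφ'
    · refine (hφ'.integrable_of_hasCompactSupport hφ'c).bdd_mul (c := Real.pi / 2) hat ?_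
      refine Eventually.of_forall fun x => ?_
      rw [Real.norm_eq_abs]
      exact (abs_lt.2 ⟨Real.neg_pi_div_two_lt_arctan _, Real.arctan_lt_pi_div_two _⟩).le
    · have := ENNReal.Tendsto.mul_const (b := eLpNorm (fun x => k * fderiv ℝ φ x e) 2 volume)
        (tendsto_eLpNorm_mollify_sub hb hv) (Or.inr (hφL'.const_mul k).2.ne)
      simpa using this
    · refine enorm_integral_le_of_abs_le (hdv n).1 (hφL'.const_mul k).1
        aestronglyMeasurable_const aestronglyMeasurable_const fun x => ?_
      have h1 := abs_arctan_sub_le (k * mollify (b n) v x) (k * v x)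
      rw [← mul_sub, abs_mul, abs_of_pos hk] at h1
      rw [← sub_mul, abs_mul, abs_mul, abs_of_pos hk]
      have h2 := mul_le_mul_of_nonneg_right h1 (abs_nonneg (fderiv ℝ φ x e))
      simp only [abs_zero, mul_zero, add_zero]
      linarith
  have hR : Tendsto (fun n => ∫ x, ((1 + (k * mollify (b n) v x) ^ 2)⁻¹ *
        (k * mollify (b n) g x)) * φ x) atTop
      (𝓝 (∫ x, ((1 + (k * v x) ^ 2)⁻¹ * (k * g x)) * φ x)) := by
    refine tendsto_integral_of_enorm_sub_le (fun n => ?_) ?_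
      (c := fun n => eLpNorm (fun x => mollify (b n) g x - g x) 2 volume *
        eLpNorm (fun x => k * φ x) 2 volume +
        eLpNorm (fun x => mollify (b n) v x - v x) 2 volume *
        eLpNorm (fun x => (k * k * M) * g x) 2 volume) ?_ fun n => ?_
    · refine Continuous.integrable_of_hasCompactSupport ?_ hφc.mul_left
      exact ((hinvc n).mul (continuous_const.mul (hgc n))).mul hφ.continuous
    · have h1 : Integrable (fun x => (k * g x) * φ x) volume := (hg.const_mul k).integrable_mul hφL
      have h2 := h1.bdd_mul (c := 1) hh (Eventually.of_forall fun x => hhle _)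
      refine h2.congr (Eventually.of_forall fun x => ?_)
      simp only [mul_assoc]
    · have h1 := ENNReal.Tendsto.mul_const (b := eLpNorm (fun x => k * φ x) 2 volume)
        (tendsto_eLpNorm_mollify_sub hb hg) (Or.inr (hφL.const_mul k).2.ne)
      have h2 := ENNReal.Tendsto.mul_const (b := eLpNorm (fun x => (k * k * M) * g x) 2 volume)
        (tendsto_eLpNorm_mollify_sub hb hv) (Or.inr (hg.const_mul _).2.ne)
      simpa using h1.add h2
    · refine enorm_integral_le_of_abs_le (hdg n).1 (hφL.const_mul k).1 (hdv n).1
        (hg.const_mul _).1 fun x => ?_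
      set s := mollify (b n) v x
      set m := mollify (b n) g x
      have hM0 : |φ x| ≤ M := hM x
      have hMp : 0 ≤ M := (abs_nonneg _).trans hM0
      have h1 := abs_inv_one_add_sq_sub_le (k * s) (k * v x)
      rw [← mul_sub, abs_mul, abs_of_pos hk] at h1
      -- The difference is split so that one term contains the error on g with a factor bounded by
      -- 1, and the other the error on v, through the Lipschitz bound on t ↦ (1 + t²)⁻¹.
      have e1 : (1 + (k * s) ^ 2)⁻¹ * (k * m) * φ x - (1 + (k * v x) ^ 2)⁻¹ * (k * g x) * φ x =
          (1 + (k * s) ^ 2)⁻¹ * ((m - g x) * (k * φ x)) +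
          ((1 + (k * s) ^ 2)⁻¹ - (1 + (k * v x) ^ 2)⁻¹) * (k * g x * φ x) := by ring
      rw [e1]
      refine (abs_add_le _ _).trans (add_le_add ?_ ?_)
      · rw [abs_mul, ← abs_mul (m - g x)]
        exact mul_le_of_le_one_left (abs_nonneg _) (hhle _)
      · rw [abs_mul]
        calc _ ≤ (k * |s - v x|) * |k * g x * φ x| := by gcongr
          _ = (k * |s - v x|) * (k * |g x| * |φ x|) := by rw [abs_mul, abs_mul, abs_of_pos hk]
          _ ≤ (k * |s - v x|) * (k * |g x| * M) := by gcongr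
          _ = _ := by rw [abs_mul (k * k * M), abs_of_nonneg (by positivity : 0 ≤ k * k * M)]; ring
  refine tendsto_nhds_unique hL ?_
  simp only [happ]
  exact hR.neg

/-- The weak derivatives of a Sobolev function vanish on its zero set. -/
theorem ae_eq_zero_of_isWeakPartial {v g : E d → ℝ} {j : Fin d} (hv : MemLp v 2 volume)
    (hg : MemLp g 2 volume) (hvg : IsWeakPartial j v g) :
    ∀ᵐ x ∂volume, v x = 0 → g x = 0 := by
  have hvm := hv.1.aemeasurable.nullMeasurable (measurableSet_singleton 0)
  set Z : Set (E d) := {x | v x = 0} with hZ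
  have hZm : NullMeasurableSet Z volume := hvm
  have hgZ : MemLp (Z.indicator g) 2 volume := by
    obtain ⟨Z', hZ', hZe⟩ := hZm.exists_measurable_superset_ae_eq
    refine (hg.indicator hZe.1).ae_eq ?_
    filter_upwards [hZe.2] with x hx
    have : (x ∈ Z') ↔ x ∈ Z := iff_of_eq hx
    by_cases h : x ∈ Z <;> simp [h, this]
  suffices h : ∀ᵐ x ∂volume, Z.indicator g x = 0 by
    filter_upwards [h] with x hx h0
    rwa [indicator_of_mem (show x ∈ Z from h0)] at hx
  refine ae_eq_zero_of_integral_contDiff_smul_eq_zero hgZ.locallyIntegrable_two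
    fun φ hφ hφc => ?_
  have hcφ : Continuous (fderiv ℝ φ) := hφ.continuous_fderiv (by simp)
  set e : E d := EuclideanSpace.single j 1
  have hφ' : Continuous fun x => fderiv ℝ φ x e := by fun_prop
  have hφ'c : HasCompactSupport fun x => fderiv ℝ φ x e := hφc.fderiv_apply ℝ _
  have hφi := hφ'.integrable_of_hasCompactSupport (μ := volume) hφ'c
  have hφL : MemLp φ 2 volume := hφ.continuous.memLp_of_hasCompactSupport hφc
  have hgφ : Integrable (fun x => g x * φ x) volume := hg.integrable_mul hφL
  have hk : ∀ n : ℕ, (0 : ℝ) < n + 1 := fun n => by positivity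
  have hinv : Tendsto (fun n : ℕ => ((n : ℝ) + 1)⁻¹) atTop (𝓝 0) := by
    simpa only [one_div] using tendsto_one_div_add_atTop_nhds_zero_nat (𝕜 := ℝ)
  have hmv : ∀ n : ℕ, AEStronglyMeasurable (fun x => ((n : ℝ) + 1) * v x) volume :=
    fun n => hv.1.const_mul _
  have hhm : ∀ n : ℕ, AEStronglyMeasurable (fun x => (1 + (((n : ℝ) + 1) * v x) ^ 2)⁻¹) volume :=
    fun n => (Continuous.inv₀ (by fun_prop) (fun t : ℝ => by positivity) :
      Continuous fun t : ℝ => (1 + t ^ 2)⁻¹).comp_aestronglyMeasurable (hmv n)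
  -- The functions arctan((n + 1)v)/(n + 1) tend uniformly to 0, while their derivatives, g times (1
  -- + ((n + 1)v)²)⁻¹, tend to g on the zero set of v and to 0 elsewhere. In the limit the integral
  -- of g φ over the zero set is 0.
  have hrel : ∀ n : ℕ, ∫ x, ((n : ℝ) + 1)⁻¹ * Real.arctan ((n + 1) * v x) * fderiv ℝ φ x e =
      -∫ x, (1 + (((n : ℝ) + 1) * v x) ^ 2)⁻¹ * (g x * φ x) := by
    intro n
    have h := isWeakPartial_arctan hv hg hvg (hk n) φ hφ hφc
    have h1 : ∫ x, ((n : ℝ) + 1)⁻¹ * Real.arctan ((n + 1) * v x) * fderiv ℝ φ x e =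
        ((n : ℝ) + 1)⁻¹ * ∫ x, Real.arctan ((n + 1) * v x) * fderiv ℝ φ x e := by
      rw [← integral_const_mul]; simp only [mul_assoc]
    rw [h1, h, mul_neg, ← integral_const_mul]
    congr 1
    refine integral_congr_ae (Eventually.of_forall fun x => ?_)
    have := (hk n).ne'
    simp only
    field_simp
  have hL : Tendsto (fun n : ℕ => ∫ x, ((n : ℝ) + 1)⁻¹ * Real.arctan ((n + 1) * v x) *
      fderiv ℝ φ x e) atTop (𝓝 (∫ _ : E d, (0 : ℝ))) := by
    refine tendsto_integral_of_dominated_convergence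
      (fun x => Real.pi / 2 * ‖fderiv ℝ φ x e‖) (fun n => ?_) (hφi.norm.const_mul _) (fun n => ?_) ?_
    · exact ((Real.continuous_arctan.comp_aestronglyMeasurable (hmv n)).const_mul _).mul
        hφ'.aestronglyMeasurable
    · refine Eventually.of_forall fun x => ?_
      rw [norm_mul, norm_mul]
      refine mul_le_mul_of_nonneg_right ?_ (norm_nonneg _)
      have h1 : ‖((n : ℝ) + 1)⁻¹‖ ≤ 1 := by
        rw [Real.norm_of_nonneg (by positivity)]
        exact inv_le_one_of_one_le₀ (by linarith [n.cast_nonneg (α := ℝ)])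
      have h2 : ‖Real.arctan ((n + 1) * v x)‖ ≤ Real.pi / 2 :=
        (abs_lt.2 ⟨Real.neg_pi_div_two_lt_arctan _, Real.arctan_lt_pi_div_two _⟩).le
      nlinarith [norm_nonneg (Real.arctan ((n + 1) * v x))]
    · refine Eventually.of_forall fun x => ?_
      have h2 : ∀ n : ℕ, ‖Real.arctan ((n + 1) * v x)‖ ≤ Real.pi / 2 := fun n =>
        (abs_lt.2 ⟨Real.neg_pi_div_two_lt_arctan _, Real.arctan_lt_pi_div_two _⟩).le
      have h3 : Tendsto (fun n : ℕ => ((n : ℝ) + 1)⁻¹ * Real.arctan ((n + 1) * v x)) atTop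
          (𝓝 0) := by
        refine squeeze_zero_norm (a := fun n : ℕ => ((n : ℝ) + 1)⁻¹ * (Real.pi / 2)) (fun n => ?_)
          (by simpa using hinv.mul_const (Real.pi / 2))
        rw [norm_mul, Real.norm_of_nonneg (by positivity : 0 ≤ ((n : ℝ) + 1)⁻¹)]
        exact mul_le_mul_of_nonneg_left (h2 n) (by positivity)
      simpa using h3.mul_const (fderiv ℝ φ x e)
  have hR : Tendsto (fun n : ℕ => ∫ x, (1 + (((n : ℝ) + 1) * v x) ^ 2)⁻¹ * (g x * φ x)) atTop
      (𝓝 (∫ x, φ x • Z.indicator g x)) := by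
    refine tendsto_integral_of_dominated_convergence (fun x => ‖g x * φ x‖)
      (fun n => (hhm n).mul hgφ.1) hgφ.norm (fun n => ?_) ?_
    · refine Eventually.of_forall fun x => ?_
      rw [norm_mul]
      refine mul_le_of_le_one_left (norm_nonneg _) ?_
      rw [Real.norm_of_nonneg (by positivity)]
      exact inv_le_one_of_one_le₀ (by nlinarith [sq_nonneg (((n : ℝ) + 1) * v x)])
    · refine Eventually.of_forall fun x => ?_
      by_cases hx : v x = 0
      · have : x ∈ Z := hx
        simp [hx, this, mul_comm]
      · have hxZ : x ∉ Z := hx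
        rw [indicator_of_notMem hxZ, smul_zero]
        have h1 : Tendsto (fun n : ℕ => 1 + (((n : ℝ) + 1) * v x) ^ 2) atTop atTop := by
          refine tendsto_atTop_add_const_left _ _ ?_
          simp only [mul_pow]
          refine Tendsto.atTop_mul_const (by positivity) ?_
          refine (tendsto_pow_atTop two_ne_zero).comp ?_
          exact tendsto_atTop_add_const_right _ _ tendsto_natCast_atTop_atTop
        simpa using h1.inv_tendsto_atTop.mul_const (g x * φ x)
  simp only [hrel, integral_zero] at hL
  have := tendsto_nhds_unique hR.neg hL
  simpa using this

/-! ## Estimates for the capacity -/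

/-- The energy in the definition of the capacity. -/
def sobolevEnergy (φ : E d → ℝ) : ℝ≥0∞ := ENNReal.ofReal (∫ x, (φ x ^ 2 + ‖fderiv ℝ φ x‖ ^ 2))

theorem sq_norm_le_sum_sq_apply_single (L : E d →L[ℝ] ℝ) :
    ‖L‖ ^ 2 ≤ ∑ j, L (EuclideanSpace.single j 1) ^ 2 := by
  set S := ∑ j, L (EuclideanSpace.single j 1) ^ 2
  have hS : 0 ≤ S := Finset.sum_nonneg fun _ _ => sq_nonneg _
  have h : ‖L‖ ≤ √S := by
    refine L.opNorm_le_bound (Real.sqrt_nonneg _) fun y => ?_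
    have h1 : L y = ∑ j, y j * L (EuclideanSpace.single j 1) := by
      conv_lhs => rw [eq_sum_coord_smul_single y]
      simp
    rw [h1, Real.norm_eq_abs]
    refine Real.abs_le_sqrt (Finset.sum_mul_sq_le_sq_mul_sq _ _ _) |>.trans ?_
    rw [Real.sqrt_mul (Finset.sum_nonneg fun _ _ => sq_nonneg _), EuclideanSpace.norm_eq, mul_comm]
    simp [S]
  calc ‖L‖ ^ 2 ≤ √S ^ 2 := by gcongr
    _ = S := Real.sq_sqrt hS

theorem integrable_energy {φ : E d → ℝ} (hφ : ContDiff ℝ 1 φ) (hc : HasCompactSupport φ) :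
    Integrable (fun x => φ x ^ 2 + ‖fderiv ℝ φ x‖ ^ 2) volume := by
  have h1 := hφ.continuous
  have h2 := hφ.continuous_fderiv one_ne_zero
  refine Continuous.integrable_of_hasCompactSupport (by fun_prop) ?_
  refine HasCompactSupport.add (hc.comp_left (g := fun t => t ^ 2) (by simp)) ?_
  exact (hc.fderiv ℝ).comp_left (g := fun t => ‖t‖ ^ 2) (by simp)

theorem sobolevEnergy_le {φ : E d → ℝ} (hφ : ContDiff ℝ 1 φ) (hc : HasCompactSupport φ) :
    sobolevEnergy φ ≤ eLpNorm φ 2 volume ^ 2 +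
      ∑ j, eLpNorm (fun x => fderiv ℝ φ x (EuclideanSpace.single j 1)) 2 volume ^ 2 := by
  have h1 := hφ.continuous
  have h2 := hφ.continuous_fderiv one_ne_zero
  rw [sobolevEnergy, ofReal_integral_eq_lintegral_ofReal (integrable_energy hφ hc)
    (Eventually.of_forall fun x => by positivity)]
  simp only [eLpNorm_two_sq]
  rw [← lintegral_finsetSum, ← lintegral_add_left]
  · refine lintegral_mono fun x => ?_
    refine (ENNReal.ofReal_le_ofReal (add_le_add le_rfl
      (sq_norm_le_sum_sq_apply_single (fderiv ℝ φ x)))).trans ?_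
    rw [ENNReal.ofReal_add (sq_nonneg _) (Finset.sum_nonneg fun _ _ => sq_nonneg _),
      ENNReal.ofReal_sum_of_nonneg fun _ _ => sq_nonneg _]
    simp only [← ofReal_norm, Real.norm_eq_abs, ← ENNReal.ofReal_pow (abs_nonneg _), sq_abs]
    exact le_rfl
  · exact (h1.enorm.measurable).pow_const 2
  · intro j _
    have : Continuous fun x => fderiv ℝ φ x (EuclideanSpace.single j 1) := by fun_prop
    exact this.enorm.measurable.pow_const 2

theorem sobolevEnergy_const_mul {φ : E d → ℝ} (hφ : ContDiff ℝ 1 φ) (c : ℝ) :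
    sobolevEnergy (fun x => c * φ x) = ENNReal.ofReal (c ^ 2) * sobolevEnergy φ := by
  rw [sobolevEnergy, sobolevEnergy, ← ENNReal.ofReal_mul (sq_nonneg _), ← integral_const_mul]
  congr 2
  funext x
  rw [fderiv_const_mul (hφ.differentiable one_ne_zero x), norm_smul, mul_pow, mul_pow,
    Real.norm_eq_abs, sq_abs]
  ring

/-- The competitor N = √(1 + S) - 1, with S the sum of the φ_a², is a smooth substitute for the
maximum of the |φ_a|. Its square is at most S, and by Cauchy–Schwarz its gradient satisfies |∇N|² ≤
S/(1 + S) · Σ|∇φ_a|². The threshold 2 ensures S ≥ 4, hence N ≥ √5 - 1 ≥ 1 on K. -/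
theorem compactCapacity_le_sum {ι : Type*} (s : Finset ι) {φ : ι → E d → ℝ}
    (hφ : ∀ a, ContDiff ℝ ∞ (φ a)) (hc : ∀ a, HasCompactSupport (φ a)) {K : Set (E d)}
    (hK : ∀ x ∈ K, ∃ a ∈ s, 2 ≤ |φ a x|) :
    compactCapacity K ≤ ∑ a ∈ s, sobolevEnergy (φ a) := by
  set S : E d → ℝ := fun x => ∑ a ∈ s, φ a x ^ 2 with hS
  have hS0 : ∀ x, 0 ≤ S x := fun x => Finset.sum_nonneg fun _ _ => sq_nonneg _
  have hSs : ContDiff ℝ ∞ S := ContDiff.sum fun a _ => (hφ a).pow 2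
  set N : E d → ℝ := fun x => √(1 + S x) - 1 with hN
  have hNs : ContDiff ℝ ∞ N :=
    ((contDiff_const.add hSs).sqrt fun x => by have := hS0 x; positivity).sub contDiff_const
  have hNc : HasCompactSupport N := by
    refine HasCompactSupport.intro (K := ⋃ a ∈ s, tsupport (φ a))
      (s.isCompact_biUnion fun a _ => hc a) fun x hx => ?_
    have : S x = 0 := Finset.sum_eq_zero fun a ha => by
      have : x ∉ tsupport (φ a) := fun h => hx (mem_biUnion ha h)
      simp [image_eq_zero_of_notMem_tsupport this]
    simp [hN, this]
  have hNK : ∀ x ∈ K, 1 ≤ N x := by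
    intro x hx
    obtain ⟨a, ha, h2⟩ := hK x hx
    have h4 : 4 ≤ S x := by
      have h5 : φ a x ^ 2 ≤ S x :=
        Finset.single_le_sum (f := fun a => φ a x ^ 2) (fun _ _ => sq_nonneg _) ha
      have : (2 : ℝ) ^ 2 ≤ φ a x ^ 2 := by rw [← sq_abs (φ a x)]; gcongr
      linarith
    have : 2 ≤ √(1 + S x) := Real.le_sqrt_of_sq_le (by linarith)
    simp only [hN]; linarith
  have hpt : ∀ x, N x ^ 2 + ‖fderiv ℝ N x‖ ^ 2 ≤
      ∑ a ∈ s, (φ a x ^ 2 + ‖fderiv ℝ (φ a) x‖ ^ 2) := by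
    intro x
    rw [Finset.sum_add_distrib]
    have hpos : 0 < 1 + S x := by have := hS0 x; positivity
    set r := √(1 + S x) with hr
    have hr2 : r ^ 2 = 1 + S x := Real.sq_sqrt hpos.le
    have hr1 : 1 ≤ r := Real.one_le_sqrt.2 (by linarith [hS0 x])
    refine add_le_add ?_ ?_
    · change (r - 1) ^ 2 ≤ S x
      nlinarith
    · have hd : ∀ a, HasFDerivAt (φ a) (fderiv ℝ (φ a) x) x := fun a =>
        ((hφ a).differentiable (by simp) x).hasFDerivAt
      have hdS : HasFDerivAt S (∑ a ∈ s, (2 * φ a x) • fderiv ℝ (φ a) x) x := by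
        have := HasFDerivAt.fun_sum (u := s) fun a _ => (hd a).pow 2
        simpa using this
      have hdN : HasFDerivAt N ((1 / (2 * r)) • ∑ a ∈ s, (2 * φ a x) • fderiv ℝ (φ a) x) x :=
        ((hdS.const_add 1).sqrt hpos.ne').sub_const 1
      rw [hdN.fderiv, norm_smul, mul_pow]
      have hb : ‖∑ a ∈ s, (2 * φ a x) • fderiv ℝ (φ a) x‖ ^ 2 ≤
          4 * S x * ∑ a ∈ s, ‖fderiv ℝ (φ a) x‖ ^ 2 := by
        calc _ ≤ (∑ a ∈ s, (2 * |φ a x|) * ‖fderiv ℝ (φ a) x‖) ^ 2 := by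
              gcongr
              refine (norm_sum_le _ _).trans (Finset.sum_le_sum fun a _ => ?_)
              rw [norm_smul, norm_mul, Real.norm_eq_abs, Real.norm_eq_abs, abs_two]
          _ ≤ (∑ a ∈ s, (2 * |φ a x|) ^ 2) * ∑ a ∈ s, ‖fderiv ℝ (φ a) x‖ ^ 2 :=
              Finset.sum_mul_sq_le_sq_mul_sq _ _ _
          _ = _ := by
              simp only [mul_pow, sq_abs, ← Finset.mul_sum, hS]; norm_num
      have hD : 0 ≤ ∑ a ∈ s, ‖fderiv ℝ (φ a) x‖ ^ 2 := Finset.sum_nonneg fun _ _ => sq_nonneg _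
      calc _ ≤ ‖1 / (2 * r)‖ ^ 2 * (4 * S x * ∑ a ∈ s, ‖fderiv ℝ (φ a) x‖ ^ 2) := by gcongr
        _ = S x / (1 + S x) * ∑ a ∈ s, ‖fderiv ℝ (φ a) x‖ ^ 2 := by
            rw [Real.norm_eq_abs, sq_abs, div_pow, mul_pow, hr2]; field_simp; ring
        _ ≤ _ := mul_le_of_le_one_left hD (by rw [div_le_one hpos]; linarith)
  refine (iInf₂_le N ⟨hNs, hNc, hNK⟩).trans ?_
  have hle : ∫ x, (N x ^ 2 + ‖fderiv ℝ N x‖ ^ 2) ≤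
      ∑ a ∈ s, ∫ x, (φ a x ^ 2 + ‖fderiv ℝ (φ a) x‖ ^ 2) := by
    have hi : ∀ a, Integrable (fun x => φ a x ^ 2 + ‖fderiv ℝ (φ a) x‖ ^ 2) volume := fun a =>
      integrable_energy ((hφ a).of_le (by exact_mod_cast le_top)) (hc a)
    rw [← integral_finsetSum _ fun a _ => hi a]
    exact integral_mono (integrable_energy (hNs.of_le (by exact_mod_cast le_top)) hNc)
      (integrable_finsetSum _ fun a _ => hi a) hpt
  refine (ENNReal.ofReal_le_ofReal hle).trans (le_of_eq ?_)
  exact ENNReal.ofReal_sum_of_nonneg fun a _ => integral_nonneg fun x => by positivity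

/-- This stands in for countable subadditivity: a compact subset is covered by finitely many of the
open sets {|φ_a| > 2}, so the finite estimate applies. -/
theorem openCapacity_le_tsum {ι : Type*} {φ : ι → E d → ℝ} (hφ : ∀ a, ContDiff ℝ ∞ (φ a))
    (hc : ∀ a, HasCompactSupport (φ a)) :
    openCapacity {x | ∃ a, 2 < |φ a x|} ≤ ∑' a, sobolevEnergy (φ a) := by
  refine iSup_le fun K => iSup_le fun hK => iSup_le fun hKU => ?_
  obtain ⟨s, hs⟩ := hK.elim_finite_subcover (fun a => {x | 2 < |φ a x|})
    (fun a => isOpen_lt continuous_const (hφ a).continuous.abs) fun x hx => by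
      obtain ⟨a, ha⟩ := hKU hx
      exact mem_iUnion.2 ⟨a, ha⟩
  refine (compactCapacity_le_sum s hφ hc fun x hx => ?_).trans (ENNReal.sum_le_tsum s)
  obtain ⟨a, ha, h2⟩ := mem_iUnion₂.1 (hs hx)
  exact ⟨a, ha, le_of_lt h2⟩

theorem openCapacity_empty : openCapacity (∅ : Set (E d)) = 0 := by
  have h := openCapacity_le_tsum (d := d) (ι := Empty) (φ := fun a => a.elim) (fun a => a.elim)
    (fun a => a.elim)
  simpa using h

theorem capacity_empty : capacity (∅ : Set (E d)) = 0 := by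
  rw [capacity_of_isOpen isOpen_empty, openCapacity_empty]

theorem isVanishingSequence_empty : IsVanishingSequence fun _ => (∅ : Set (E d)) :=
  ⟨fun _ _ _ => le_rfl, fun _ => isOpen_empty, by simp [openCapacity_empty]⟩

theorem _root_.IsOpen.isQuasiOpen {U : Set (E d)} (hU : IsOpen U) : IsQuasiOpen U :=
  ⟨_, isVanishingSequence_empty, fun _ => by simpa using hU⟩

theorem _root_.Continuous.isQuasiContinuous {f : E d → ℝ} (hf : Continuous f) :
    IsQuasiContinuous f :=
  ⟨_, isVanishingSequence_empty, fun _ => hf.continuousOn⟩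

/-! ### Comparison of capacity with Lebesgue measure. -/

theorem volume_le_compactCapacity {K : Set (E d)} (hK : IsCompact K) :
    volume K ≤ compactCapacity K := by
  refine le_iInf₂ fun φ hφ => ?_
  obtain ⟨hs, hc, h1⟩ := hφ
  have hi := integrable_energy (hs.of_le (by exact_mod_cast le_top)) hc
  rw [ofReal_integral_eq_lintegral_ofReal hi (Eventually.of_forall fun x => by positivity),
    ← lintegral_indicator_one hK.measurableSet]
  refine lintegral_mono fun x => ?_
  by_cases hx : x ∈ K
  · have := h1 x hx
    rw [indicator_of_mem hx, Pi.one_apply, ← ENNReal.ofReal_one]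
    refine ENNReal.ofReal_le_ofReal ?_
    nlinarith [sq_nonneg ‖fderiv ℝ φ x‖]
  · simp [hx]

theorem volume_le_openCapacity {U : Set (E d)} (hU : IsOpen U) : volume U ≤ openCapacity U := by
  rw [hU.measure_eq_iSup_isCompact]
  refine iSup₂_le fun K hKU => iSup_le fun hK => ?_
  exact (volume_le_compactCapacity hK).trans
    (le_iSup_of_le K (le_iSup_of_le hK (le_iSup_of_le hKU le_rfl)))

theorem volume_le_capacity (A : Set (E d)) : volume A ≤ capacity A :=
  le_iInf fun _ => le_iInf fun hU => le_iInf fun hAU =>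
    (measure_mono hAU).trans (volume_le_openCapacity hU)

theorem IsVanishingSequence.volume_iInter {U : ℕ → Set (E d)} (hU : IsVanishingSequence U) :
    volume (⋂ k, U k) = 0 := by
  refine le_antisymm (ge_of_tendsto' hU.2.2 fun k => ?_) zero_le
  exact (measure_mono (iInter_subset U k)).trans (volume_le_openCapacity (hU.2.1 k))

/-- The union of Ω with the intersection of the U k is a countable intersection of open sets, and
the intersection of the U k is null because capacity dominates volume. -/
theorem IsQuasiOpen.nullMeasurableSet {Ω : Set (E d)} (hΩ : IsQuasiOpen Ω) :
    NullMeasurableSet Ω volume := by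
  obtain ⟨U, hU, h⟩ := hΩ
  have h1 : MeasurableSet (⋂ k, (Ω ∪ U k)) := MeasurableSet.iInter fun k => (h k).measurableSet
  refine h1.nullMeasurableSet.congr ?_
  rw [← union_iInter]
  exact union_ae_eq_left_of_ae_eq_empty (ae_eq_empty.2 hU.volume_iInter)

theorem MemW12Zero.ae_eq_zero {Ω : Set (E d)} {v : E d → ℝ} (h : MemW12Zero Ω v) :
    ∀ᵐ x ∂volume, x ∉ Ω → v x = 0 := by
  obtain ⟨-, w, -, hvw, hw⟩ := h
  have h0 : volume {x | x ∉ Ω ∧ w x ≠ 0} = 0 := le_antisymm ((volume_le_capacity _).trans hw.le)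
    zero_le
  have h1 : ∀ᵐ x ∂volume, ¬ (x ∉ Ω ∧ w x ≠ 0) := by
    rw [ae_iff]; simpa using h0
  filter_upwards [hvw, h1] with x hx hx1 hxΩ
  rw [hx]
  by_contra hne
  exact hx1 ⟨hxΩ, hne⟩

/-! ## Quasi-continuous representatives -/

theorem mollify_eq_zero {φ : ContDiffBump (0 : E d)} {v : E d → ℝ} {D : Set (E d)}
    (h0 : ∀ᵐ x ∂volume, x ∉ D → v x = 0) {x : E d} (hx : ∀ t ∈ D, φ.rOut ≤ ‖x - t‖) :
    mollify φ v x = 0 := by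
  rw [mollify_apply']
  refine integral_eq_zero_of_ae ?_
  filter_upwards [h0] with t ht
  by_cases htD : t ∈ D
  · have : x - t ∉ Function.support (φ.normed (volume : Measure (E d))) := by
      rw [φ.support_normed_eq, mem_ball_zero_iff, not_lt]
      exact hx t htD
    simp [Function.notMem_support.1 this]
  · simp [ht htD]

theorem hasCompactSupport_mollify (φ : ContDiffBump (0 : E d)) {v : E d → ℝ} {D : Set (E d)}
    (hD : IsCompact D) (h0 : ∀ᵐ x ∂volume, x ∉ D → v x = 0) :
    HasCompactSupport (mollify φ v) := by
  refine HasCompactSupport.intro (hD.cthickening (r := φ.rOut)) fun x hx => ?_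
  refine mollify_eq_zero h0 fun t ht => ?_
  by_contra hlt
  refine hx (Metric.mem_cthickening_of_dist_le x t _ D ht ?_)
  rw [dist_eq_norm]
  exact (not_le.1 hlt).le

theorem tendsto_mollify_of_notMem {b : ℕ → ContDiffBump (0 : E d)}
    (hb : Tendsto (fun n => (b n).rOut) atTop (𝓝 0)) {v : E d → ℝ} {D : Set (E d)}
    (hD : IsClosed D) (h0 : ∀ᵐ x ∂volume, x ∉ D → v x = 0) {x : E d} (hx : x ∉ D) :
    Tendsto (fun n => mollify (b n) v x) atTop (𝓝 0) := by
  obtain ⟨δ, hδ, hball⟩ := Metric.isOpen_iff.1 hD.isOpen_compl x hx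
  refine tendsto_const_nhds.congr' ?_
  filter_upwards [hb.eventually (gt_mem_nhds hδ)] with n hn
  refine (mollify_eq_zero h0 fun t ht => ?_).symm
  by_contra hlt
  have htb : t ∈ Metric.ball x δ := by
    rw [Metric.mem_ball, dist_comm, dist_eq_norm]
    exact (not_le.1 hlt).trans hn
  exact hball htb ht

/-- Rapidly converging mollifications of finitely many functions. -/
theorem exists_mollify_rapid {κ : Type*} [Finite κ] {u : κ → E d → ℝ}
    (hu : ∀ a, MemLp (u a) 2 volume) :
    ∃ b : ℕ → ContDiffBump (0 : E d), Tendsto (fun n => (b n).rOut) atTop (𝓝 0) ∧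
      ∀ n a, eLpNorm (fun x => mollify (b n) (u a) x - u a x) 2 volume ≤ (4⁻¹ : ℝ≥0∞) ^ n := by
  have hev : ∀ n : ℕ, ∀ᶠ m in atTop, ∀ a,
      eLpNorm (fun x => mollify (shrinkingBump m) (u a) x - u a x) 2 volume ≤
        (4⁻¹ : ℝ≥0∞) ^ n := by
    intro n
    rw [eventually_all]
    intro a
    exact (ENNReal.tendsto_nhds_zero.1
      (tendsto_eLpNorm_mollify_sub tendsto_rOut_shrinkingBump (hu a))) _ (by
        simp [pos_iff_ne_zero])
  obtain ⟨σ, hσ, h⟩ := extraction_forall_of_eventually hev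
  exact ⟨fun n => shrinkingBump (σ n), tendsto_rOut_shrinkingBump.comp hσ.tendsto_atTop, h⟩

/-- Smooth functions that converge rapidly in energy converge uniformly outside open sets of small
capacity. -/
theorem exists_isVanishingSequence_of_energy_le {ι : Type*} [Fintype ι] {f : ℕ → ι → E d → ℝ}
    (hf : ∀ n i, ContDiff ℝ ∞ (f n i)) (hc : ∀ n i, HasCompactSupport (f n i)) {C : ℝ≥0∞}
    (hC : C ≠ ⊤)
    (hE : ∀ n i, sobolevEnergy (fun x => f (n + 1) i x - f n i x) ≤ C * (16⁻¹ : ℝ≥0∞) ^ n) :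
    ∃ U : ℕ → Set (E d), IsVanishingSequence U ∧
      ∀ k, ∀ x ∉ U k, ∀ n i, |f (n + k + 1) i x - f (n + k) i x| ≤ 1 / 2 ^ n := by
  -- With the weight 2^(n+1), the bound |ψ| ≤ 2 gives |f (n+1) - f n| ≤ 2^(-n). The energy is
  -- multiplied by 4 · 4^n, which the decay 16^(-n) absorbs, leaving a summable 4^(-n).
  set ψ : ℕ → ι → E d → ℝ := fun n i x => 2 ^ (n + 1) * (f (n + 1) i x - f n i x) with hψ
  have hψs : ∀ n i, ContDiff ℝ ∞ (ψ n i) := fun n i =>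
    contDiff_const.mul ((hf _ i).sub (hf _ i))
  have hψc : ∀ n i, HasCompactSupport (ψ n i) := fun n i =>
    ((hc (n + 1) i).sub (hc n i)).mul_left
  have hψE : ∀ n i, sobolevEnergy (ψ n i) ≤ 4 * C * (4⁻¹ : ℝ≥0∞) ^ n := by
    intro n i
    have hs : ContDiff ℝ 1 fun x => f (n + 1) i x - f n i x :=
      ((hf _ i).sub (hf _ i)).of_le (by exact_mod_cast le_top)
    rw [hψ, sobolevEnergy_const_mul hs]
    have e1 : ENNReal.ofReal ((2 ^ (n + 1)) ^ 2) = 4 * 4 ^ n := by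
      rw [← pow_mul, mul_comm, pow_mul, ENNReal.ofReal_pow (by norm_num)]
      norm_num [pow_succ, mul_comm]
    have e2 : (4 : ℝ≥0∞) ^ n * (16⁻¹ : ℝ≥0∞) ^ n = (4⁻¹ : ℝ≥0∞) ^ n := by
      rw [← mul_pow]
      congr 1
      rw [show (16 : ℝ≥0∞) = 4 * 4 by norm_num,
        ENNReal.mul_inv (Or.inl (by norm_num)) (Or.inl (by norm_num)), ← mul_assoc,
        ENNReal.mul_inv_cancel (by norm_num) (by norm_num), one_mul]
    calc _ ≤ 4 * 4 ^ n * (C * (16⁻¹ : ℝ≥0∞) ^ n) := by rw [e1]; gcongr; exact hE n i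
      _ = 4 * C * (4 ^ n * (16⁻¹ : ℝ≥0∞) ^ n) := by ring
      _ = _ := by rw [e2]
  set T : ℕ → ℝ≥0∞ := fun n => ∑ i, sobolevEnergy (ψ n i) with hT
  have hTsum : ∑' n, T n ≠ ⊤ := by
    refine ne_top_of_le_ne_top (b := ∑' n, (Fintype.card ι * (4 * C)) * (4⁻¹ : ℝ≥0∞) ^ n) ?_
      (ENNReal.tsum_le_tsum fun n => ?_)
    · rw [ENNReal.tsum_mul_left, ENNReal.tsum_geometric]
      refine ENNReal.mul_ne_top (ENNReal.mul_ne_top (by simp) (ENNReal.mul_ne_top (by simp) hC)) ?_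
      rw [ENNReal.inv_ne_top]
      refine (tsub_pos_of_lt ?_).ne'
      exact ENNReal.inv_lt_one.2 (by norm_num)
    · refine (Finset.sum_le_sum fun i _ => hψE n i).trans (le_of_eq ?_)
      simp [mul_assoc]
  -- The set of index k collects the bad points of all levels n ≥ k, so the sets decrease and their
  -- capacities are bounded by tails of a convergent series.
  refine ⟨fun k => {x | ∃ a : ℕ × ι, 2 < |ψ (a.1 + k) a.2 x|}, ⟨?_, ?_, ?_⟩, ?_⟩
  · rintro k l hkl x ⟨⟨n, i⟩, hx⟩
    exact ⟨⟨n + (l - k), i⟩, by simpa [show n + (l - k) + k = n + l by omega] using hx⟩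
  · intro k
    simp only [ofPred_exists]
    exact isOpen_iUnion fun a => isOpen_lt continuous_const (hψs _ _).continuous.abs
  · refine tendsto_of_tendsto_of_tendsto_of_le_of_le tendsto_const_nhds
      (ENNReal.tendsto_sum_nat_add T hTsum) (fun _ => zero_le) fun k => ?_
    refine (openCapacity_le_tsum (φ := fun a : ℕ × ι => ψ (a.1 + k) a.2) (fun a => hψs _ _)
      fun a => hψc _ _).trans (le_of_eq ?_)
    rw [ENNReal.tsum_prod']
    simp [hT, tsum_fintype]
  · intro k x hx n i
    have h2 : |ψ (n + k) i x| ≤ 2 := not_lt.1 fun h => hx ⟨⟨n, i⟩, h⟩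
    rw [hψ, abs_mul, abs_of_pos (by positivity : (0 : ℝ) < 2 ^ (n + k + 1))] at h2
    rw [le_div_iff₀ (by positivity)]
    have h3 : (2 : ℝ) ^ (n + k + 1) = 2 * 2 ^ k * 2 ^ n := by ring
    rw [h3] at h2
    have h4 : (1 : ℝ) ≤ 2 ^ k := one_le_pow₀ (by norm_num)
    have h5 : 0 ≤ |f (n + k + 1) i x - f (n + k) i x| * 2 ^ n := by positivity
    nlinarith

/-- Finitely many Sobolev functions supported in a compact set have quasi-continuous
representatives that vanish outside this set and that share their exceptional sets. -/
theorem exists_quasiContinuous_representatives {ι : Type*} [Fintype ι] {D : Set (E d)}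
    (hD : IsCompact D) {v : ι → E d → ℝ} (hv : ∀ i, MemW12 (v i))
    (h0 : ∀ i, ∀ᵐ x ∂volume, x ∉ D → v i x = 0) :
    ∃ (w : ι → E d → ℝ) (U : ℕ → Set (E d)), IsVanishingSequence U ∧
      (∀ i k, ContinuousOn (w i) (U k)ᶜ) ∧ (∀ i, v i =ᵐ[volume] w i) ∧
      ∀ i, ∀ x ∉ D, w i x = 0 := by
  classical
  have hv2 : ∀ i, MemLp (v i) 2 volume := fun i => (hv i).1
  choose g hg hvg using fun i => (hv i).2
  -- The functions and all their weak partials share the same kernels, so that the energies of the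
  -- successive differences are controlled.
  obtain ⟨b, hb, hbr⟩ := exists_mollify_rapid
    (u := fun a : ι ⊕ ι × Fin d => Sum.elim v (fun p => g p.1 p.2) a)
    (by rintro (i | ⟨i, j⟩); exacts [hv2 i, hg i j])
  set f : ℕ → ι → E d → ℝ := fun n i => mollify (b n) (v i) with hf
  have hfs : ∀ n i, ContDiff ℝ ∞ (f n i) := fun n i =>
    contDiff_mollify _ (hv2 i).locallyIntegrable_two
  have hfc : ∀ n i, HasCompactSupport (f n i) := fun n i => hasCompactSupport_mollify _ hD (h0 i)
  have hdiff : ∀ n (u : E d → ℝ), MemLp u 2 volume →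
      (∀ n, eLpNorm (fun x => mollify (b n) u x - u x) 2 volume ≤ (4⁻¹ : ℝ≥0∞) ^ n) →
      eLpNorm (fun x => mollify (b (n + 1)) u x - mollify (b n) u x) 2 volume ^ 2 ≤
        4 * (16⁻¹ : ℝ≥0∞) ^ n := by
    intro n u hu hr
    have hm : ∀ n, MemLp (fun x => mollify (b n) u x - u x) 2 volume := fun n =>
      (memLp_mollify _ hu).sub hu
    have e : (fun x => mollify (b (n + 1)) u x - mollify (b n) u x) =
        (fun x => mollify (b (n + 1)) u x - u x) - fun x => mollify (b n) u x - u x := by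
      funext x; simp
    have h1 : eLpNorm (fun x => mollify (b (n + 1)) u x - mollify (b n) u x) 2 volume ≤
        2 * (4⁻¹ : ℝ≥0∞) ^ n := by
      rw [e, two_mul]
      refine (eLpNorm_sub_le (hm _).1 (hm _).1 (by norm_num)).trans (add_le_add ?_ (hr n))
      refine (hr (n + 1)).trans (pow_le_pow_right_of_le_one' ?_ n.le_succ)
      exact ENNReal.inv_le_one.2 (by norm_num)
    refine (pow_le_pow_left' h1 2).trans (le_of_eq ?_)
    rw [mul_pow, ← pow_mul, mul_comm n 2, pow_mul, ← ENNReal.inv_pow]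
    norm_num
  have hE : ∀ n i, sobolevEnergy (fun x => f (n + 1) i x - f n i x) ≤
      (4 + d * 4) * (16⁻¹ : ℝ≥0∞) ^ n := by
    intro n i
    refine (sobolevEnergy_le (((hfs _ i).sub (hfs _ i)).of_le (by exact_mod_cast le_top))
      ((hfc _ i).sub (hfc _ i))).trans ?_
    rw [add_mul]
    refine add_le_add (hdiff n (v i) (hv2 i) fun n => hbr n (Sum.inl i)) ?_
    have hj : ∀ j ∈ Finset.univ, eLpNorm (fun x => fderiv ℝ (fun x => f (n + 1) i x - f n i x) x
        (EuclideanSpace.single j 1)) 2 volume ^ 2 ≤ 4 * (16⁻¹ : ℝ≥0∞) ^ n := by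
      intro j _
      have e : (fun x => fderiv ℝ (fun x => f (n + 1) i x - f n i x) x
          (EuclideanSpace.single j 1)) =
          fun x => mollify (b (n + 1)) (g i j) x - mollify (b n) (g i j) x := by
        funext x
        rw [fderiv_fun_sub ((hfs _ i).differentiable (by simp) x)
          ((hfs _ i).differentiable (by simp) x), _root_.sub_apply,
          fderiv_mollify _ (hv2 i).locallyIntegrable_two (hvg i j),
          fderiv_mollify _ (hv2 i).locallyIntegrable_two (hvg i j)]
      rw [e]
      exact hdiff n (g i j) (hg i j) fun n => hbr n (Sum.inr (i, j))
    refine (Finset.sum_le_sum hj).trans (le_of_eq ?_)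
    simp [mul_assoc]
  obtain ⟨U, hU, hUf⟩ := exists_isVanishingSequence_of_energy_le hfs hfc
    (ENNReal.add_ne_top.2 ⟨by norm_num, ENNReal.mul_ne_top (by simp) (by norm_num)⟩) hE
  -- The pointwise limit of the mollifications wherever it exists. Outside D they vanish eventually,
  -- so the limit exists and is 0 at every point there, not only almost everywhere.
  set w : ι → E d → ℝ := fun i x =>
    if h : ∃ l, Tendsto (fun n => f n i x) atTop (𝓝 l) then h.choose else 0 with hw
  have hwl : ∀ i x l, Tendsto (fun n => f n i x) atTop (𝓝 l) → w i x = l := by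
    intro i x l hl
    have hex : ∃ l, Tendsto (fun n => f n i x) atTop (𝓝 l) := ⟨l, hl⟩
    simp only [hw, dif_pos hex]
    exact tendsto_nhds_unique hex.choose_spec hl
  have hgeo : ∀ k, ∀ x ∉ U k, ∀ i n, dist (f (n + k) i x) (f (n + 1 + k) i x) ≤ 2 / 2 / 2 ^ n := by
    intro k x hx i n
    have := hUf k x hx n i
    rw [dist_comm, Real.dist_eq, show n + 1 + k = n + k + 1 by omega]
    simpa using this
  have hlim : ∀ k, ∀ x ∉ U k, ∀ i, Tendsto (fun n => f n i x) atTop (𝓝 (w i x)) := by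
    intro k x hx i
    obtain ⟨l, hl⟩ := cauchySeq_tendsto_of_complete (cauchySeq_of_le_geometric_two
      (hgeo k x hx i))
    have hl' := (tendsto_add_atTop_iff_nat (f := fun n => f n i x) k).1 hl
    rwa [hwl i x l hl']
  refine ⟨w, U, hU, fun i k => ?_, fun i => ?_, fun i x hx => ?_⟩
  · have hunif : TendstoUniformlyOn (fun n => f (n + k) i) (w i) atTop (U k)ᶜ := by
      rw [Metric.tendstoUniformlyOn_iff]
      intro ε hε
      have h2 : Tendsto (fun n : ℕ => (2 : ℝ) / 2 ^ n) atTop (𝓝 0) := by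
        have := (tendsto_pow_atTop_nhds_zero_of_lt_one (r := (1 / 2 : ℝ)) (by norm_num)
          (by norm_num)).const_mul 2
        simpa [div_eq_mul_inv] using this
      filter_upwards [h2.eventually (gt_mem_nhds hε)] with n hn x hx
      rw [dist_comm]
      refine lt_of_le_of_lt ?_ hn
      exact dist_le_of_le_geometric_two_of_tendsto (hgeo k x hx i)
        ((tendsto_add_atTop_iff_nat (f := fun n => f n i x) k).2 (hlim k x hx i)) n
    exact hunif.continuousOn (Eventually.of_forall fun n =>
      (hfs _ i).continuous.continuousOn).frequently
  -- A subsequence of the mollifications converges almost everywhere to v, while off the null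
  -- intersection of the U k the whole sequence converges to w.
  · have hm := tendstoInMeasure_of_tendsto_eLpNorm (p := 2) (by norm_num)
      (fun n => (memLp_mollify (b n) (hv2 i)).1) (hv2 i).1
      (tendsto_eLpNorm_mollify_sub hb (hv2 i))
    obtain ⟨σ, hσ, hae⟩ := hm.exists_seq_tendsto_ae
    have hnull : ∀ᵐ x ∂volume, x ∉ ⋂ k, U k := measure_eq_zero_iff_ae_notMem.1 hU.volume_iInter
    filter_upwards [hae, hnull] with x hx hxU
    simp only [mem_iInter, not_forall] at hxU
    obtain ⟨k, hk⟩ := hxU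
    exact tendsto_nhds_unique hx ((hlim k x hk i).comp hσ.tendsto_atTop)
  · exact hwl i x 0 (tendsto_mollify_of_notMem hb hD.isClosed (h0 i) hx)

/-- A Sobolev vector field supported in a compact set vanishes outside a quasi-open subset of it,
which is the set of the points where the field is not zero. -/
theorem exists_isQuasiOpen_support {ι : Type*} [Fintype ι] {D : Set (E d)}
    (hD : IsCompact D) {v : ι → E d → ℝ} (hv : ∀ i, MemW12 (v i))
    (h0 : ∀ i, ∀ᵐ x ∂volume, x ∉ D → v i x = 0) :
    ∃ Ω : Set (E d), IsQuasiOpen Ω ∧ Ω ⊆ D ∧ (∀ i, MemW12Zero Ω (v i)) ∧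
      ∀ᵐ x ∂volume, x ∈ Ω ↔ ∃ i, v i x ≠ 0 := by
  obtain ⟨w, U, hU, hwU, hvw, hw0⟩ := exists_quasiContinuous_representatives hD hv h0
  refine ⟨{x | ∃ i, w i x ≠ 0}, ⟨U, hU, fun k => ?_⟩, ?_, fun i => ?_, ?_⟩
  · have : {x | ∃ i, w i x ≠ 0} ∪ U k = (⋃ i, {x | w i x ≠ 0} ∪ U k) ∪ U k := by
      ext x; simp only [mem_union, mem_ofPred_eq, mem_iUnion]; grind
    rw [this]
    refine (isOpen_iUnion fun i => ?_).union (hU.2.1 k)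
    -- The zero set of w i within the closed complement of U k is closed, by continuity of w i
    -- there.
    have hcl := ContinuousOn.preimage_isClosed_of_isClosed (hwU i k)
      (hU.2.1 k).isClosed_compl (isClosed_singleton (x := (0 : ℝ)))
    rw [← isClosed_compl_iff]
    convert hcl using 1
    ext x
    simp [and_comm]
  · rintro x ⟨i, hx⟩
    by_contra hxD
    exact hx (hw0 i x hxD)
  · refine ⟨hv i, w i, ⟨U, hU, hwU i⟩, hvw i, ?_⟩
    convert capacity_empty (d := d)
    refine eq_empty_of_forall_notMem fun x hx => hx.1 ⟨i, hx.2⟩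
  · filter_upwards [ae_all_iff.2 hvw] with x hx
    simp [hx]

/-! ## Weak convergence in `L²` and Rellich's theorem -/

/-- Weak convergence of sequences in `L²`. -/
def WeaklyTendsto (v : ℕ → E d → ℝ) (u : E d → ℝ) : Prop :=
  ∀ f : E d → ℝ, MemLp f 2 volume →
    Tendsto (fun n => ∫ x, v n x * f x) atTop (𝓝 (∫ x, u x * f x))

theorem WeaklyTendsto.comp {v : ℕ → E d → ℝ} {u : E d → ℝ} (h : WeaklyTendsto v u) {σ : ℕ → ℕ}
    (hσ : StrictMono σ) : WeaklyTendsto (fun n => v (σ n)) u :=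
  fun f hf => (h f hf).comp hσ.tendsto_atTop

theorem integrable_mul_of_memLp_two {f g : E d → ℝ} (hf : MemLp f 2 volume)
    (hg : MemLp g 2 volume) : Integrable (fun x => f x * g x) volume :=
  hf.integrable_mul hg

theorem inner_toLp_eq_integral {f g : E d → ℝ} (hf : MemLp f 2 volume) (hg : MemLp g 2 volume) :
    inner ℝ (hf.toLp f) (hg.toLp g) = ∫ x, f x * g x := by
  rw [L2.inner_def]
  refine integral_congr_ae ?_
  filter_upwards [hf.coeFn_toLp, hg.coeFn_toLp] with x h1 h2
  simp [h1, h2, mul_comm]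

/-- L² is identified with its dual by Riesz's theorem, where closed balls are weak-* sequentially
compact. -/
theorem exists_subseq_weaklyTendsto {v : ℕ → E d → ℝ} (hv : ∀ n, MemLp (v n) 2 volume)
    {C : NNReal} (hC : ∀ n, eLpNorm (v n) 2 volume ≤ C) :
    ∃ σ : ℕ → ℕ, StrictMono σ ∧ ∃ u, MemLp u 2 volume ∧ WeaklyTendsto (fun n => v (σ n)) u := by
  have : Fact ((2 : ℝ≥0∞) ≠ ⊤) := ⟨by norm_num⟩
  let H := Lp ℝ 2 (volume : Measure (E d))
  let V : ℕ → WeakDual ℝ H := fun n =>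
    WeakDual.toStrongDual.symm (InnerProductSpace.toDual ℝ H ((hv n).toLp (v n)))
  obtain ⟨x, -, σ, hσ, hx⟩ := WeakDual.isSeqCompact_closedBall ℝ H 0 (C : ℝ) (x := V) (by
    intro n
    change InnerProductSpace.toDual ℝ H ((hv n).toLp (v n)) ∈ Metric.closedBall 0 (C : ℝ)
    rw [mem_closedBall_zero_iff, LinearIsometryEquiv.norm_map, Lp.norm_toLp]
    exact ENNReal.toReal_le_of_le_ofReal C.coe_nonneg (by simpa using hC n))
  set u : H := (InnerProductSpace.toDual ℝ H).symm (WeakDual.toStrongDual x) with hu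
  refine ⟨σ, hσ, u, Lp.memLp u, fun f hf => ?_⟩
  have h1 := ((WeakDual.eval_continuous (hf.toLp f)).tendsto x).comp hx
  have e1 : ∀ n, V n (hf.toLp f) = ∫ x, v n x * f x := fun n =>
    inner_toLp_eq_integral (hv n) hf
  have e2 : x (hf.toLp f) = ∫ x, u x * f x := by
    have h3 : x (hf.toLp f) = inner ℝ u (hf.toLp f) := by
      rw [← InnerProductSpace.toDual_apply_apply, hu, LinearIsometryEquiv.apply_symm_apply]; rfl
    rw [h3, ← inner_toLp_eq_integral (Lp.memLp u) hf, Lp.toLp_coeFn]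
  rw [← e2]
  refine h1.congr fun n => ?_
  exact e1 (σ n)

theorem exists_common_subseq_weaklyTendsto {κ : Type*} [Finite κ] {v : κ → ℕ → E d → ℝ}
    (hv : ∀ a n, MemLp (v a n) 2 volume) {C : NNReal} (hC : ∀ a n, eLpNorm (v a n) 2 volume ≤ C) :
    ∃ σ : ℕ → ℕ, StrictMono σ ∧
      ∃ u : κ → E d → ℝ, ∀ a, MemLp (u a) 2 volume ∧ WeaklyTendsto (fun n => v a (σ n)) (u a) := by
  classical
  have := Fintype.ofFinite κ
  have key : ∀ s : Finset κ, ∃ σ : ℕ → ℕ, StrictMono σ ∧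
      ∀ a ∈ s, ∃ u, MemLp u 2 volume ∧ WeaklyTendsto (fun n => v a (σ n)) u := by
    intro s
    induction s using Finset.induction_on with
    | empty => exact ⟨id, strictMono_id, by simp⟩
    | insert a s _ ih =>
      obtain ⟨σ, hσ, h⟩ := ih
      obtain ⟨τ, hτ, u, hu, hw⟩ := exists_subseq_weaklyTendsto (v := fun n => v a (σ n))
        (fun n => hv a _) (fun n => hC a _)
      refine ⟨σ ∘ τ, hσ.comp hτ, fun b hb => ?_⟩
      rcases Finset.mem_insert.1 hb with rfl | hb
      · exact ⟨u, hu, hw⟩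
      · obtain ⟨u', hu', hw'⟩ := h b hb
        exact ⟨u', hu', hw'.comp hτ⟩
  obtain ⟨σ, hσ, h⟩ := key Finset.univ
  choose u hu using fun a => h a (Finset.mem_univ a)
  exact ⟨σ, hσ, u, hu⟩

theorem memLp_of_contDiff {φ : E d → ℝ} (hφ : ContDiff ℝ ∞ φ) (hc : HasCompactSupport φ) :
    MemLp φ 2 volume :=
  hφ.continuous.memLp_of_hasCompactSupport hc

theorem memLp_fderiv_apply {φ : E d → ℝ} (hφ : ContDiff ℝ ∞ φ) (hc : HasCompactSupport φ)
    (e : E d) : MemLp (fun x => fderiv ℝ φ x e) 2 volume := by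
  have := hφ.continuous_fderiv (by simp)
  exact Continuous.memLp_of_hasCompactSupport (by fun_prop) (hc.fderiv_apply ℝ e)

/-- Test functions and their derivatives lie in L², so both sides of the defining identity pass to
weak limits. -/
theorem isWeakPartial_of_weaklyTendsto {j : Fin d} {v g : ℕ → E d → ℝ} {u h : E d → ℝ}
    (hv : WeaklyTendsto v u) (hg : WeaklyTendsto g h) (hvg : ∀ n, IsWeakPartial j (v n) (g n)) :
    IsWeakPartial j u h := by
  intro φ hφ hc
  refine tendsto_nhds_unique (hv _ (memLp_fderiv_apply hφ hc _)) ?_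
  simp only [hvg _ φ hφ hc]
  exact (hg φ (memLp_of_contDiff hφ hc)).neg

theorem IsWeakPartial.sub {j : Fin d} {v g u h : E d → ℝ} (hv : MemLp v 2 volume)
    (hg : MemLp g 2 volume) (hu : MemLp u 2 volume) (hh : MemLp h 2 volume)
    (hvg : IsWeakPartial j v g) (huh : IsWeakPartial j u h) :
    IsWeakPartial j (fun x => v x - u x) fun x => g x - h x := by
  intro φ hφ hc
  have h1 := memLp_of_contDiff hφ hc
  have h2 := memLp_fderiv_apply hφ hc (EuclideanSpace.single j 1)
  simp only [sub_mul]
  rw [integral_sub (integrable_mul_of_memLp_two hv h2) (integrable_mul_of_memLp_two hu h2),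
    integral_sub (integrable_mul_of_memLp_two hg h1) (integrable_mul_of_memLp_two hh h1), hvg φ hφ hc, huh φ hφ hc]
  ring

theorem IsWeakPartial.const_mul {j : Fin d} {v g : E d → ℝ} (hvg : IsWeakPartial j v g) (c : ℝ) :
    IsWeakPartial j (fun x => c * v x) fun x => c * g x := by
  intro φ hφ hc
  simp only [mul_assoc, integral_const_mul, hvg φ hφ hc, mul_neg]

/-- A property that holds almost everywhere for the terms of a weakly convergent sequence:
vanishing on a given set. -/
theorem WeaklyTendsto.ae_eq_zero {v : ℕ → E d → ℝ} {u : E d → ℝ} (hw : WeaklyTendsto v u)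
    (hu : MemLp u 2 volume) {A : Set (E d)} (hA : MeasurableSet A)
    (h : ∀ n, ∀ᵐ x ∂volume, x ∈ A → v n x = 0) : ∀ᵐ x ∂volume, x ∈ A → u x = 0 := by
  -- Testing the weak convergence against u restricted to A shows that the integral of u² over A is
  -- 0.
  have hi : MemLp (A.indicator u) 2 volume := hu.indicator hA
  have h0 := hw _ hi
  have e : ∀ n, ∫ x, v n x * A.indicator u x = 0 := fun n => by
    refine integral_eq_zero_of_ae ?_
    filter_upwards [h n] with x hx
    by_cases hxA : x ∈ A <;> simp [hxA, hx]
  simp only [e] at h0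
  have h1 : ∫ x, u x * A.indicator u x = 0 := tendsto_nhds_unique h0 tendsto_const_nhds
  have h2 : (fun x => u x * A.indicator u x) =ᵐ[volume] 0 := by
    rw [← integral_eq_zero_iff_of_nonneg _ (integrable_mul_of_memLp_two hu hi)]
    · exact h1
    · intro x
      by_cases hxA : x ∈ A <;> simp [hxA, mul_self_nonneg]
  filter_upwards [h2] with x hx hxA
  simpa [hxA] using hx

/-- The value of a mollification at a point is a pairing with a fixed L² function, so weak
convergence becomes pointwise convergence. -/
theorem WeaklyTendsto.tendsto_mollify {z : ℕ → E d → ℝ} {u : E d → ℝ} (hw : WeaklyTendsto z u)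
    (φ : ContDiffBump (0 : E d)) (x : E d) :
    Tendsto (fun n => mollify φ (z n) x) atTop (𝓝 (mollify φ u x)) := by
  have hρ : MemLp (φ.normed (volume : Measure (E d))) 2 volume :=
    φ.continuous_normed.memLp_of_hasCompactSupport φ.hasCompactSupport_normed
  have hx : MemLp (fun t => φ.normed (volume : Measure (E d)) (x - t)) 2 volume :=
    hρ.comp_measurePreserving (Measure.measurePreserving_sub_left volume x)
  have := hw _ hx
  simpa only [mollify_apply', mul_comm] using this

theorem enorm_mollify_le (φ : ContDiffBump (0 : E d)) {f : E d → ℝ} (hf : MemLp f 2 volume)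
    (x : E d) :
    ‖mollify φ f x‖ₑ ≤ eLpNorm (φ.normed (volume : Measure (E d))) 2 volume *
      eLpNorm f 2 volume := by
  have hρ : AEStronglyMeasurable (φ.normed (volume : Measure (E d))) volume :=
    φ.continuous_normed.aestronglyMeasurable
  have hmp := Measure.measurePreserving_sub_left (volume : Measure (E d)) x
  rw [mollify_apply']
  have := enorm_integral_le_of_abs_le (c := fun t => φ.normed volume (x - t) * f t)
    (hρ.comp_measurePreserving hmp) hf.1
    (aestronglyMeasurable_const (b := (0 : ℝ))) (aestronglyMeasurable_const (b := (0 : ℝ)))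
    fun t => by simp [abs_mul]
  rw [eLpNorm_comp_measurePreserving hρ hmp] at this
  simpa using this

/-- Weakly null sequences that are bounded in `W^{1,2}` and supported in a fixed compact set
are strongly null in `L²`. -/
theorem tendsto_eLpNorm_of_weaklyTendsto_zero {D : Set (E d)} (hD : IsCompact D)
    {z : ℕ → E d → ℝ} {g : ℕ → Fin d → E d → ℝ} (hz : ∀ n, MemLp (z n) 2 volume)
    (hg : ∀ n j, MemLp (g n j) 2 volume) (hzg : ∀ n j, IsWeakPartial j (z n) (g n j))
    (h0 : ∀ n, ∀ᵐ x ∂volume, x ∉ D → z n x = 0) {C : ℝ≥0∞} (hC : C ≠ ⊤)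
    (hzC : ∀ n, eLpNorm (z n) 2 volume ≤ C) (hgC : ∀ n, ∑ j, eLpNorm (g n j) 2 volume ≤ C)
    (hw : WeaklyTendsto z fun _ => 0) :
    Tendsto (fun n => eLpNorm (z n) 2 volume) atTop (𝓝 0) := by
  -- For a fixed kernel the mollifications tend to 0 pointwise, are bounded by B, and vanish outside
  -- a fixed compact thickening of D: dominated convergence applies.
  have hmoll : ∀ φ : ContDiffBump (0 : E d),
      Tendsto (fun n => eLpNorm (mollify φ (z n)) 2 volume ^ 2) atTop (𝓝 0) := by
    intro φ
    set B : ℝ≥0∞ := eLpNorm (φ.normed (volume : Measure (E d))) 2 volume * C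
    have hB : B ≠ ⊤ := ENNReal.mul_ne_top
      (φ.continuous_normed.memLp_of_hasCompactSupport φ.hasCompactSupport_normed).2.ne hC
    set K := Metric.cthickening φ.rOut D
    have hK : IsCompact K := hD.cthickening
    simp only [eLpNorm_two_sq]
    have hlim : ∀ x, Tendsto (fun n => ‖mollify φ (z n) x‖ₑ ^ 2) atTop (𝓝 0) := by
      intro x
      have h1 := hw.tendsto_mollify φ x
      have h2 : mollify φ (fun _ => 0) x = 0 := by simp [mollify_apply]
      rw [h2] at h1
      have h3 := ENNReal.Tendsto.pow (n := 2) h1.enorm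
      simpa using h3
    have := tendsto_lintegral_of_dominated_convergence (μ := volume) (f := fun _ => 0)
      (F := fun n x => ‖mollify φ (z n) x‖ₑ ^ 2) (K.indicator fun _ => B ^ 2) (fun n => ?_)
      (fun n => ?_) ?_ (Eventually.of_forall hlim)
    · simpa using this
    · exact (contDiff_mollify φ (hz n).locallyIntegrable_two).continuous.enorm.measurable.pow_const 2
    · refine Eventually.of_forall fun x => ?_
      by_cases hx : x ∈ K
      · rw [indicator_of_mem hx]
        have := (enorm_mollify_le φ (hz n) x).trans (mul_le_mul_right (hzC n) _)
        change _ ^ 2 ≤ B ^ 2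
        gcongr
      · have h1 : mollify φ (z n) x = 0 := by
          refine mollify_eq_zero (h0 n) fun t ht => ?_
          by_contra hlt
          refine hx (Metric.mem_cthickening_of_dist_le x t _ D ht ?_)
          rw [dist_eq_norm]
          exact (not_le.1 hlt).le
        simp [h1]
    · rw [lintegral_indicator_const hK.measurableSet]
      exact ENNReal.mul_ne_top (ENNReal.pow_ne_top hB) hK.measure_lt_top.ne
  -- The translation estimate bounds the mollification error by `rOut * C`, uniformly in n; hence
  -- the kernel can be fixed before n grows.
  have hrO : Tendsto (fun k => ENNReal.ofReal
      (shrinkingBump k : ContDiffBump (0 : E d)).rOut * C) atTop (𝓝 0) := by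
    have h1 := ENNReal.tendsto_ofReal (tendsto_rOut_shrinkingBump (d := d))
    simpa using ENNReal.Tendsto.mul_const h1 (Or.inr hC)
  rw [ENNReal.tendsto_nhds_zero]
  intro ε hε
  have hε2 : 0 < ε / 2 := ENNReal.half_pos hε.ne'
  obtain ⟨k, hk⟩ := ((ENNReal.tendsto_nhds_zero.1 hrO) _ hε2).exists
  set φ : ContDiffBump (0 : E d) := shrinkingBump k
  filter_upwards [(ENNReal.tendsto_nhds_zero.1 (hmoll φ)) ((ε / 2) ^ 2)
    (ENNReal.pow_pos hε2 2)] with n hn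
  have hn' : eLpNorm (mollify φ (z n)) 2 volume ≤ ε / 2 :=
    (ENNReal.pow_le_pow_left_iff two_ne_zero).1 hn
  have hm := memLp_mollify φ (hz n)
  have e : z n = mollify φ (z n) - fun x => mollify φ (z n) x - z n x := by
    funext x; simp
  rw [e, ← ENNReal.add_halves ε]
  refine (eLpNorm_sub_le hm.1 (hm.sub (hz n)).1 (by norm_num)).trans (add_le_add hn' ?_)
  refine (eLpNorm_mollify_sub_le φ (hz n) fun y hy => ?_).trans hk
  refine (eLpNorm_translate_sub_le (hz n) (hg n) (hzg n) y).trans ?_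
  refine mul_le_mul' ?_ (hgC n)
  rw [← ofReal_norm]
  exact ENNReal.ofReal_le_ofReal hy.le

/-- **Rellich's theorem**. -/
theorem tendsto_eLpNorm_sub_of_weaklyTendsto {D : Set (E d)} (hD : IsCompact D)
    {v : ℕ → E d → ℝ} {g : ℕ → Fin d → E d → ℝ} {u : E d → ℝ} {h : Fin d → E d → ℝ}
    (hv : ∀ n, MemLp (v n) 2 volume) (hg : ∀ n j, MemLp (g n j) 2 volume)
    (hvg : ∀ n j, IsWeakPartial j (v n) (g n j)) (hu : MemLp u 2 volume)
    (hh : ∀ j, MemLp (h j) 2 volume) (huh : ∀ j, IsWeakPartial j u (h j))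
    (hv0 : ∀ n, ∀ᵐ x ∂volume, x ∉ D → v n x = 0) (hu0 : ∀ᵐ x ∂volume, x ∉ D → u x = 0)
    {C : NNReal} (hvC : ∀ n, eLpNorm (v n) 2 volume ≤ C)
    (hgC : ∀ n j, eLpNorm (g n j) 2 volume ≤ C) (hw : WeaklyTendsto v u) :
    Tendsto (fun n => eLpNorm (fun x => v n x - u x) 2 volume) atTop (𝓝 0) := by
  set C' : ℝ≥0∞ := (C + eLpNorm u 2 volume) + ∑ j, (C + eLpNorm (h j) 2 volume)
  have hC' : C' ≠ ⊤ := by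
    refine ENNReal.add_ne_top.2 ⟨ENNReal.add_ne_top.2 ⟨by simp, hu.2.ne⟩, ?_⟩
    refine (ENNReal.sum_lt_top.2 fun j _ => ?_).ne
    exact ENNReal.add_lt_top.2 ⟨by simp, (hh j).2⟩
  refine tendsto_eLpNorm_of_weaklyTendsto_zero hD (fun n => (hv n).sub hu)
    (g := fun n j x => g n j x - h j x) (fun n j => (hg n j).sub (hh j))
    (fun n j => (hvg n j).sub (hv n) (hg n j) hu (hh j) (huh j)) (fun n => ?_) hC' (fun n => ?_)
    (fun n => ?_) fun f hf => ?_
  · filter_upwards [hv0 n, hu0] with x h1 h2 hx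
    simp [h1 hx, h2 hx]
  · refine (eLpNorm_sub_le (hv n).1 hu.1 (by norm_num)).trans ?_
    exact (add_le_add (hvC n) le_rfl).trans le_self_add
  · refine le_trans (Finset.sum_le_sum fun j _ => ?_) le_add_self
    exact (eLpNorm_sub_le (hg n j).1 (hh j).1 (by norm_num)).trans (add_le_add (hgC n j) le_rfl)
  · have h1 := (hw f hf).sub_const (∫ x, u x * f x)
    simp only [sub_mul, zero_mul, integral_zero]
    rw [sub_self] at h1
    refine h1.congr fun n => ?_
    rw [integral_sub (integrable_mul_of_memLp_two (hv n) hf) (integrable_mul_of_memLp_two hu hf)]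

/-- Weak lower semicontinuity of the sum of the squared norms. -/
theorem sum_integral_sq_le_of_weaklyTendsto {κ : Type*} [Fintype κ] {v : κ → ℕ → E d → ℝ}
    {u : κ → E d → ℝ} (hv : ∀ a n, MemLp (v a n) 2 volume) (hu : ∀ a, MemLp (u a) 2 volume)
    (hw : ∀ a, WeaklyTendsto (v a) (u a)) {m : ℝ}
    (hm : Tendsto (fun n => ∑ a, ∫ x, v a n x ^ 2) atTop (𝓝 m)) :
    ∑ a, ∫ x, u a x ^ 2 ≤ m := by
  have hlim : Tendsto (fun n => ∑ a, ∫ x, v a n x * u a x) atTop (𝓝 (∑ a, ∫ x, u a x ^ 2)) := by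
    simp only [sq]
    exact tendsto_finsetSum _ fun a _ => hw a _ (hu a)
  -- The sum of the integrals of (v - u)² is nonnegative; expanded, it tends to m minus the sum of
  -- the integrals of u².
  have h2 := ge_of_tendsto' ((hm.sub (hlim.const_mul 2)).add
    (tendsto_const_nhds (x := ∑ a, ∫ x, u a x ^ 2))) (b := 0) fun n => ?_
  · linarith
  · rw [Finset.mul_sum, ← Finset.sum_sub_distrib, ← Finset.sum_add_distrib]
    refine Finset.sum_nonneg fun a _ => ?_
    have e : ∫ x, (v a n x - u a x) ^ 2 =
        (∫ x, v a n x ^ 2) - 2 * (∫ x, v a n x * u a x) + ∫ x, u a x ^ 2 := by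
      rw [← integral_const_mul, ← integral_sub (hv a n).integrable_sq
        ((integrable_mul_of_memLp_two (hv a n) (hu a)).const_mul 2), ← integral_add _ (hu a).integrable_sq]
      · congr 1; funext x; ring
      · exact (hv a n).integrable_sq.sub ((integrable_mul_of_memLp_two (hv a n) (hu a)).const_mul 2)
    rw [← e]
    exact integral_nonneg fun x => sq_nonneg _

/-! ## A solenoidal test field in a given open set -/

theorem memW12_of_contDiff {f : E d → ℝ} (hf : ContDiff ℝ ∞ f) (hc : HasCompactSupport f) :
    MemW12 f :=
  ⟨memLp_of_contDiff hf hc, fun j => ⟨_, memLp_fderiv_apply hf hc _,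
    isWeakPartial_fderiv (hf.of_le (by exact_mod_cast le_top)) j⟩⟩

theorem memW12Zero_of_contDiff {f : E d → ℝ} (hf : ContDiff ℝ ∞ f) (hc : HasCompactSupport f)
    {Ω : Set (E d)} (hΩ : ∀ x ∉ Ω, f x = 0) : MemW12Zero Ω f := by
  refine ⟨memW12_of_contDiff hf hc, f, hf.continuous.isQuasiContinuous, ae_eq_refl _, ?_⟩
  convert capacity_empty (d := d)
  exact eq_empty_of_forall_notMem fun x hx => hx.2 (hΩ x hx.1)

/-- The field is the rotated gradient (∂₁ψ, -∂₀ψ, 0, …, 0) of a bump function ψ supported in the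
open set. Its divergence vanishes by symmetry of the second derivative. -/
theorem exists_isStokesTest_of_isOpen (hd : 2 ≤ d) {B : Set (E d)} (hB : IsOpen B)
    (hne : B.Nonempty) :
    ∃ (u : E d → E d) (G : E d → Matrix (Fin d) (Fin d) ℝ), IsStokesTest B u G := by
  obtain ⟨c, hc⟩ := hne
  obtain ⟨r, hr, hrB⟩ := Metric.isOpen_iff.1 hB c hc
  let ψ : ContDiffBump c := ⟨r / 4, r / 2, by positivity, by linarith⟩
  have hψ : ContDiff ℝ ∞ ψ := ψ.contDiff
  have hψc : HasCompactSupport ψ := ψ.hasCompactSupport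
  let i₀ : Fin d := ⟨0, by omega⟩
  let i₁ : Fin d := ⟨1, by omega⟩
  have h01 : i₀ ≠ i₁ := by simp [i₀, i₁]
  let e : Fin d → E d := fun j => EuclideanSpace.single j 1
  let w : Fin d → E d := fun i => if i = i₀ then e i₁ else if i = i₁ then -e i₀ else 0
  have hψ' : ContDiff ℝ ∞ (fderiv ℝ ψ) := hψ.fderiv_right (by simp)
  have ha : ∀ i, ContDiff ℝ ∞ fun x => fderiv ℝ ψ x (w i) := fun i =>
    hψ'.clm_apply contDiff_const
  have hac : ∀ i, HasCompactSupport fun x => fderiv ℝ ψ x (w i) := fun i => hψc.fderiv_apply ℝ _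
  have h0 : ∀ x ∉ B, ∀ i, fderiv ℝ ψ x (w i) = 0 := by
    intro x hx i
    have : x ∉ tsupport ψ := fun h => hx (hrB (by
      rw [ψ.tsupport_eq] at h
      exact Metric.closedBall_subset_ball (by change r / 2 < r; linarith) h))
    have h2 : x ∉ Function.support (fderiv ℝ ψ) := fun h =>
      this (support_fderiv_subset ℝ h)
    simp [Function.notMem_support.1 h2]
  refine ⟨fun x => WithLp.toLp 2 fun i => fderiv ℝ ψ x (w i),
    fun x => Matrix.of fun i j => fderiv ℝ (fun x => fderiv ℝ ψ x (w i)) x (e j), ?_, ?_, ?_, ?_⟩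
  · exact fun i => memW12Zero_of_contDiff (ha i) (hac i) fun x hx => h0 x hx i
  · exact fun i j => ⟨memLp_fderiv_apply (ha i) (hac i) _,
      isWeakPartial_fderiv ((ha i).of_le (by exact_mod_cast le_top)) j⟩
  · refine Eventually.of_forall fun x => ?_
    have hsym : IsSymmSndFDerivAt ℝ ψ x :=
      hψ.contDiffAt.isSymmSndFDerivAt (by
        rw [minSmoothness_of_isRCLikeNormedField]; exact WithTop.coe_le_coe.2 (le_top : (2 : ℕ∞) ≤ ⊤))
    have hG : ∀ i j, fderiv ℝ (fun x => fderiv ℝ ψ x (w i)) x (e j) =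
        fderiv ℝ (fderiv ℝ ψ) x (e j) (w i) := by
      intro i j
      have h1 : HasFDerivAt (fderiv ℝ ψ) (fderiv ℝ (fderiv ℝ ψ) x) x :=
        (hψ'.differentiable (by simp) x).hasFDerivAt
      rw [(h1.clm_apply (hasFDerivAt_const (w i) x)).fderiv]
      simp
    simp only [Matrix.trace, Matrix.diag_apply, Matrix.of_apply, hG]
    rw [Finset.sum_eq_add i₀ i₁ h01]
    · have : w i₁ = -e i₀ := by simp [w, h01.symm]
      rw [this, show w i₀ = e i₁ by simp [w], hsym.eq (e i₀) (e i₁)]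
      simp
    · rintro i - ⟨hi0, hi1⟩
      simp [w, hi0, hi1]
    · simp
    · simp
  · intro hae
    have h1 : (fun x => fderiv ℝ ψ x (w i₀)) =ᵐ[volume] fun _ => 0 := by
      filter_upwards [hae] with x hx
      have := congrArg (fun y : E d => y i₀) hx
      simpa using this
    have h2 := ((ha i₀).continuous.ae_eq_iff_eq volume continuous_const).1 h1
    have h3 : ∀ x, fderiv ℝ ψ x (e i₁) = 0 := fun x => by
      have := congrFun h2 x
      simpa [w] using this
    -- If the field were zero, ψ would be constant along the line through c in the direction `e i₁`,
    -- although it equals 1 at c and 0 at distance r.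
    have hline : ∀ t : ℝ, HasDerivAt (fun t : ℝ => ψ (c + t • e i₁)) 0 t := by
      intro t
      have h4 : HasDerivAt (fun t : ℝ => c + t • e i₁) (e i₁) t := by
        simpa using ((hasDerivAt_id t).smul_const (e i₁)).const_add c
      have h5 := (hψ.differentiable (by simp) (c + t • e i₁)).hasFDerivAt.comp_hasDerivAt t h4
      exact h5.congr_deriv (h3 _)
    have hconst := is_const_of_deriv_eq_zero (fun t => (hline t).differentiableAt)
      (fun t => (hline t).deriv) 0 r
    have hr0 : ψ (c + r • e i₁) = 0 := by
      refine ψ.zero_of_le_dist ?_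
      change r / 2 ≤ _
      have : ‖e i₁‖ = 1 := by simp [e]
      rw [dist_eq_norm, add_sub_cancel_left, norm_smul, this, mul_one, Real.norm_of_nonneg hr.le]
      linarith
    have h10 : ψ c = 1 := ψ.one_of_mem_closedBall (Metric.mem_closedBall_self (by positivity))
    rw [hr0] at hconst
    simp [h10] at hconst

/-- A point has volume zero, so by outer regularity it has open neighbourhoods of volume below V₀.
-/
theorem exists_isOpen_mem_admissibleClass (hd : 2 ≤ d) {D : Set (E d)}
    (hD : (interior D).Nonempty) {V₀ : ℝ} (hV₀ : 0 < V₀) :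
    ∃ B ∈ admissibleClass D V₀, IsOpen B ∧ B.Nonempty := by
  obtain ⟨c, hc⟩ := hD
  have : Nontrivial (Fin d) := Fin.nontrivial_iff_two_le.2 hd
  have hv : volume ({c} : Set (E d)) < ENNReal.ofReal V₀ := by simpa using hV₀
  obtain ⟨U, hcU, hU, hUV⟩ := Set.exists_isOpen_lt_of_lt _ _ hv
  have hB : IsOpen (interior D ∩ U) := isOpen_interior.inter hU
  exact ⟨interior D ∩ U, ⟨hB.isQuasiOpen, inter_subset_left.trans interior_subset,
    (measure_mono inter_subset_right).trans hUV.le⟩, hB, c, hc, hcU rfl⟩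

/-! ## Existence of an optimal set -/

/-- `g` is the weak Jacobian matrix of the divergence-free field `v`, which vanishes almost
everywhere outside `Ω`. -/
structure IsSolenoidal (Ω : Set (E d)) (v : Fin d → E d → ℝ) (g : Fin d → Fin d → E d → ℝ) :
    Prop where
  memLp : ∀ i, MemLp (v i) 2 volume
  memLp_grad : ∀ i j, MemLp (g i j) 2 volume
  weakPartial : ∀ i j, IsWeakPartial j (v i) (g i j)
  ae_eq_zero : ∀ i, ∀ᵐ x ∂volume, x ∉ Ω → v i x = 0
  div_eq_zero : ∀ᵐ x ∂volume, ∑ i, g i i x = 0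

theorem IsSolenoidal.grad_ae_eq_zero {Ω : Set (E d)} {v : Fin d → E d → ℝ}
    {g : Fin d → Fin d → E d → ℝ} (h : IsSolenoidal Ω v g) (i j : Fin d) :
    ∀ᵐ x ∂volume, x ∉ Ω → g i j x = 0 := by
  filter_upwards [h.ae_eq_zero i,
    ae_eq_zero_of_isWeakPartial (h.memLp i) (h.memLp_grad i j) (h.weakPartial i j)] with x h1 h2 hx
  exact h2 (h1 hx)

theorem IsSolenoidal.const_mul {Ω : Set (E d)} {v : Fin d → E d → ℝ}
    {g : Fin d → Fin d → E d → ℝ} (h : IsSolenoidal Ω v g) (c : ℝ) :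
    IsSolenoidal Ω (fun i x => c * v i x) (fun i j x => c * g i j x) where
  memLp i := (h.memLp i).const_mul c
  memLp_grad i j := (h.memLp_grad i j).const_mul c
  weakPartial i j := (h.weakPartial i j).const_mul c
  ae_eq_zero i := by
    filter_upwards [h.ae_eq_zero i] with x hx hxΩ
    simp [hx hxΩ]
  div_eq_zero := by
    filter_upwards [h.div_eq_zero] with x hx
    rw [← Finset.mul_sum, hx, mul_zero]

/-- The field vanishes outside Ω, hence so does its Jacobian, almost everywhere. The quotient thus
no longer depends on Ω, which allows fields living on different sets to be compared. -/
theorem IsSolenoidal.rayleigh_eq {Ω : Set (E d)} {v : Fin d → E d → ℝ}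
    {g : Fin d → Fin d → E d → ℝ} (h : IsSolenoidal Ω v g) :
    rayleigh Ω (fun x => WithLp.toLp 2 fun i => v i x) (fun x => Matrix.of fun i j => g i j x) =
      (∑ i, ∑ j, ∫ x, g i j x ^ 2) / ∑ i, ∫ x, v i x ^ 2 := by
  have hg : ∀ᵐ x ∂volume, ∀ i j, x ∉ Ω → g i j x = 0 :=
    ae_all_iff.2 fun i => ae_all_iff.2 fun j => h.grad_ae_eq_zero i j
  have hv : ∀ᵐ x ∂volume, ∀ i, x ∉ Ω → v i x = 0 := ae_all_iff.2 h.ae_eq_zero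
  rw [rayleigh, setIntegral_eq_integral_of_ae_compl_eq_zero,
    setIntegral_eq_integral_of_ae_compl_eq_zero]
  · simp only [Matrix.of_apply, EuclideanSpace.real_norm_sq_eq]
    rw [integral_finsetSum _ fun i _ => (h.memLp i).integrable_sq,
      integral_finsetSum _ fun i _ => integrable_finsetSum _ fun j _ =>
        (h.memLp_grad i j).integrable_sq]
    congr 1
    exact Finset.sum_congr rfl fun i _ => integral_finsetSum _ fun j _ =>
      (h.memLp_grad i j).integrable_sq
  · filter_upwards [hv] with x hx hxΩ
    simp [EuclideanSpace.real_norm_sq_eq, hx _ hxΩ]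
  · filter_upwards [hg] with x hx hxΩ
    simp [hx _ _ hxΩ]

/-- The divergence vanishes in Ω by assumption, and outside Ω because the gradient vanishes on the
zero set of the field. Quasi-openness serves to make Ω null-measurable, so that the restricted
measure can be unfolded. -/
theorem IsStokesTest.isSolenoidal {Ω : Set (E d)} (hΩ : IsQuasiOpen Ω) {u : E d → E d}
    {G : E d → Matrix (Fin d) (Fin d) ℝ} (h : IsStokesTest Ω u G) :
    IsSolenoidal Ω (fun i x => u x i) fun i j x => G x i j where
  memLp i := (h.mem i).1.1
  memLp_grad i j := (h.jacobian i j).1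
  weakPartial i j := (h.jacobian i j).2
  ae_eq_zero i := (h.mem i).ae_eq_zero
  div_eq_zero := by
    have h1 := (ae_restrict_iff'₀ hΩ.nullMeasurableSet).1 h.div_eq_zero
    have h2 : ∀ᵐ x ∂volume, ∀ i, x ∉ Ω → G x i i = 0 := ae_all_iff.2 fun i => by
      filter_upwards [(h.mem i).ae_eq_zero, ae_eq_zero_of_isWeakPartial (h.mem i).1.1
        (h.jacobian i i).1 (h.jacobian i i).2] with x h1 h2 hx
      exact h2 (h1 hx)
    filter_upwards [h1, h2] with x h1 h2
    by_cases hx : x ∈ Ω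
    · exact h1 hx
    · exact Finset.sum_eq_zero fun i _ => h2 i hx

theorem IsStokesTest.exists_normalized {Ω : Set (E d)} (hΩ : IsQuasiOpen Ω) {u : E d → E d}
    {G : E d → Matrix (Fin d) (Fin d) ℝ} (h : IsStokesTest Ω u G) :
    ∃ v g, IsSolenoidal Ω v g ∧ ∑ i, ∫ x, v i x ^ 2 = 1 ∧
      ∑ i, ∑ j, ∫ x, g i j x ^ 2 = rayleigh Ω u G := by
  have hs := h.isSolenoidal hΩ
  have hr := hs.rayleigh_eq
  change rayleigh Ω u G = _ at hr
  set s : ℝ := ∑ i, ∫ x, u x i ^ 2 with hs_def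
  have hs0 : 0 ≤ s := Finset.sum_nonneg fun i _ => integral_nonneg fun x => sq_nonneg _
  have hs1 : s ≠ 0 := by
    intro h0
    have h1 := (Finset.sum_eq_zero_iff_of_nonneg fun i _ =>
      integral_nonneg fun x => sq_nonneg (u x i)).1 h0
    refine h.ne_zero ?_
    have h2 : ∀ᵐ x ∂volume, ∀ i, u x i = 0 := ae_all_iff.2 fun i => by
      have h3 := (integral_eq_zero_iff_of_nonneg (fun x => sq_nonneg (u x i))
        (hs.memLp i).integrable_sq).1 (h1 i (Finset.mem_univ i))
      filter_upwards [h3] with x hx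
      simpa using hx
    filter_upwards [h2] with x hx
    ext i
    simpa using hx i
  have hpos : 0 < s := lt_of_le_of_ne hs0 hs1.symm
  have hc : (√s)⁻¹ ^ 2 = s⁻¹ := by rw [inv_pow, Real.sq_sqrt hs0]
  refine ⟨_, _, hs.const_mul (√s)⁻¹, ?_, ?_⟩
  · simp only [mul_pow, integral_const_mul, hc, ← Finset.mul_sum]
    exact inv_mul_cancel₀ hs1
  · simp only [mul_pow, integral_const_mul, hc, ← Finset.mul_sum]
    rw [hr, div_eq_inv_mul]

/-! ### Passage to the limit along a minimizing sequence. -/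

theorem eLpNorm_two_sq_eq_ofReal {f : E d → ℝ} (hf : MemLp f 2 volume) :
    eLpNorm f 2 volume ^ 2 = ENNReal.ofReal (∫ x, f x ^ 2) := by
  rw [eLpNorm_two_sq, ofReal_integral_eq_lintegral_ofReal hf.integrable_sq
    (Eventually.of_forall fun x => sq_nonneg _)]
  refine lintegral_congr fun x => ?_
  rw [← ofReal_norm, ← ENNReal.ofReal_pow (norm_nonneg _), Real.norm_eq_abs, sq_abs]

theorem eLpNorm_two_le_of_integral_sq_le {f : E d → ℝ} (hf : MemLp f 2 volume) {C : NNReal}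
    (h : ∫ x, f x ^ 2 ≤ (C : ℝ) ^ 2) : eLpNorm f 2 volume ≤ C := by
  refine (ENNReal.pow_le_pow_left_iff two_ne_zero).1 ?_
  rw [eLpNorm_two_sq_eq_ofReal hf, ← ENNReal.ofReal_coe_nnreal,
    ← ENNReal.ofReal_pow C.coe_nonneg]
  exact ENNReal.ofReal_le_ofReal h

/-- By v² = (v - u)² + 2vu - u²: strong convergence handles the square and weak convergence the
cross term. -/
theorem tendsto_integral_sq {v : ℕ → E d → ℝ} {u : E d → ℝ} (hv : ∀ n, MemLp (v n) 2 volume)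
    (hu : MemLp u 2 volume) (hw : WeaklyTendsto v u)
    (hs : Tendsto (fun n => eLpNorm (fun x => v n x - u x) 2 volume) atTop (𝓝 0)) :
    Tendsto (fun n => ∫ x, v n x ^ 2) atTop (𝓝 (∫ x, u x ^ 2)) := by
  have hd : ∀ n, MemLp (fun x => v n x - u x) 2 volume := fun n => (hv n).sub hu
  have h1 : Tendsto (fun n => ∫ x, (v n x - u x) ^ 2) atTop (𝓝 0) := by
    have h2 := ENNReal.Tendsto.pow (n := 2) hs
    simp only [eLpNorm_two_sq_eq_ofReal (hd _)] at h2
    have h3 := (ENNReal.tendsto_toReal (by simp)).comp h2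
    simp only [ne_eq, OfNat.ofNat_ne_zero, not_false_eq_true, zero_pow, ENNReal.toReal_zero] at h3
    refine h3.congr fun n => ENNReal.toReal_ofReal (integral_nonneg fun x => sq_nonneg _)
  have h2 := (h1.add ((hw u hu).const_mul 2)).sub_const (∫ x, u x * u x)
  have e : 0 + 2 * (∫ x, u x * u x) - ∫ x, u x * u x = ∫ x, u x ^ 2 := by
    simp only [sq]; ring
  rw [e] at h2
  refine h2.congr fun n => ?_
  have hi := (integrable_mul_of_memLp_two (hv n) hu).const_mul 2
  have hi2 : Integrable (fun x => (v n x - u x) ^ 2 + 2 * (v n x * u x)) volume :=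
    (hd n).integrable_sq.add hi
  rw [← integral_const_mul, ← integral_add (hd n).integrable_sq hi, ← integral_sub
    hi2 (integrable_mul_of_memLp_two hu hu)]
  congr 1
  funext x
  ring

/-- The volume of the set where a strong limit does not vanish. -/
theorem volume_support_le {ι : Type*} [Fintype ι] {Ω : ℕ → Set (E d)} {V : ℝ≥0∞}
    (hΩ : ∀ n, volume (Ω n) ≤ V) {v : ℕ → ι → E d → ℝ} {u : ι → E d → ℝ}
    (hv : ∀ n i, MemLp (v n i) 2 volume) (hu : ∀ i, MemLp (u i) 2 volume)
    (hv0 : ∀ n i, ∀ᵐ x ∂volume, x ∉ Ω n → v n i x = 0)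
    (hs : ∀ i, Tendsto (fun n => eLpNorm (fun x => v n i x - u i x) 2 volume) atTop (𝓝 0)) :
    volume {x | ∃ i, u i x ≠ 0} ≤ V := by
  set s : ℕ → E d → ℝ := fun n => ∑ i, fun x => ‖v n i x - u i x‖ with hs_def
  have hd : ∀ n i, MemLp (fun x => v n i x - u i x) 2 volume := fun n i => (hv n i).sub (hu i)
  have hsm : ∀ n, AEStronglyMeasurable (s n) volume := fun n =>
    Finset.aestronglyMeasurable_sum _ fun i _ => (hd n i).1.norm
  have hlim : Tendsto (fun n => eLpNorm (s n) 2 volume) atTop (𝓝 0) := by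
    have h1 : Tendsto (fun n => ∑ i, eLpNorm (fun x => v n i x - u i x) 2 volume) atTop
        (𝓝 (∑ _i : ι, 0)) := tendsto_finsetSum _ fun i _ => hs i
    rw [Finset.sum_const_zero] at h1
    refine tendsto_of_tendsto_of_tendsto_of_le_of_le tendsto_const_nhds h1 (fun _ => zero_le)
      fun n => ?_
    refine (eLpNorm_sum_le (fun i _ => (hd n i).1.norm) (by norm_num)).trans
      (Finset.sum_le_sum fun i _ => ?_)
    rw [eLpNorm_norm]
  obtain ⟨σ, hσ, hae⟩ := (tendstoInMeasure_of_tendsto_eLpNorm (p := 2) (g := fun _ => 0)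
    (by norm_num) hsm aestronglyMeasurable_const (by
      refine hlim.congr fun n => ?_
      congr 1; funext x; simp)).exists_seq_tendsto_ae
  have hall : ∀ᵐ x ∂volume, ∀ n i, x ∉ Ω n → v n i x = 0 :=
    ae_all_iff.2 fun n => ae_all_iff.2 fun i => hv0 n i
  -- Whenever x is outside Ω (σ n), the error s (σ n) x is at least |u i x|. As the error tends to
  -- 0, a point with u i x ≠ 0 lies in all the sets from some index on. The resulting increasing
  -- union consists of sets of volume at most V.
  have hsub : {x | ∃ i, u i x ≠ 0} ≤ᵐ[volume] ⋃ N, ⋂ n ≥ N, Ω (σ n) := by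
    filter_upwards [hae, hall] with x hx hxa hxu
    obtain ⟨i, hi⟩ := hxu
    obtain ⟨N, hN⟩ := eventually_atTop.1 (hx.eventually (gt_mem_nhds (norm_pos_iff.2 hi)))
    refine mem_iUnion.2 ⟨N, mem_iInter₂.2 fun n hn => ?_⟩
    by_contra hnot
    have h1 := hN n hn
    have h2 : ‖u i x‖ ≤ s (σ n) x := by
      have h3 : ‖v (σ n) i x - u i x‖ ≤ ∑ i, ‖v (σ n) i x - u i x‖ :=
        Finset.single_le_sum (f := fun i => ‖v (σ n) i x - u i x‖) (fun _ _ => norm_nonneg _)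
          (Finset.mem_univ i)
      rw [hxa _ i hnot, zero_sub, norm_neg] at h3
      simpa [hs_def] using h3
    exact absurd h1 (not_lt.2 h2)
  refine (measure_mono_ae hsub).trans ?_
  rw [Monotone.measure_iUnion]
  · exact iSup_le fun N => (measure_mono (biInter_subset_of_mem (show N ∈ {n | n ≥ N} from
      le_refl N))).trans (hΩ _)
  · intro N M hNM
    exact biInter_mono (fun n (hn : M ≤ n) => hNM.trans hn) fun _ _ => Subset.rfl

/-- The compactness argument: the Rayleigh quotients of minimizing sequences of sets and fields
have a limit that is not exceeded by the Rayleigh quotient of some admissible set and field. -/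
theorem exists_isStokesTest_le {D : Set (E d)} (hD : IsCompact D) {V₀ : ℝ} {Ω : ℕ → Set (E d)}
    (hΩ : ∀ n, Ω n ∈ admissibleClass D V₀) {v : ℕ → Fin d → E d → ℝ}
    {g : ℕ → Fin d → Fin d → E d → ℝ} (h : ∀ n, IsSolenoidal (Ω n) (v n) (g n))
    (h1 : ∀ n, ∑ i, ∫ x, v n i x ^ 2 = 1) {m : ℝ}
    (hm : Tendsto (fun n => ∑ i, ∑ j, ∫ x, g n i j x ^ 2) atTop (𝓝 m)) :
    ∃ Ωs ∈ admissibleClass D V₀, ∃ u G, IsStokesTest Ωs u G ∧ rayleigh Ωs u G ≤ m := by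
  obtain ⟨R, hR⟩ := hm.bddAbove_range
  have hR' : ∀ n, ∑ i, ∑ j, ∫ x, g n i j x ^ 2 ≤ R := fun n => hR ⟨n, rfl⟩
  have hsq : ∀ f : E d → ℝ, 0 ≤ ∫ x, f x ^ 2 := fun f => integral_nonneg fun x => sq_nonneg _
  have hR0 : 0 ≤ R := (Finset.sum_nonneg fun i _ => Finset.sum_nonneg fun j _ =>
    hsq (g 0 i j)).trans (hR' 0)
  -- As R ≥ 0, the square of 1 + R dominates both 1 and R, so C bounds the fields and the Jacobian
  -- entries alike.
  set C : NNReal := ⟨1 + R, by positivity⟩ with hC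
  have hCc : (C : ℝ) = 1 + R := rfl
  have hvC : ∀ n i, eLpNorm (v n i) 2 volume ≤ C := fun n i => by
    refine eLpNorm_two_le_of_integral_sq_le ((h n).memLp i) ?_
    have := Finset.single_le_sum (f := fun i => ∫ x, v n i x ^ 2) (fun i _ => hsq (v n i))
      (Finset.mem_univ i)
    simp only [h1 n] at this
    rw [hCc]; nlinarith
  have hgC : ∀ n i j, eLpNorm (g n i j) 2 volume ≤ C := fun n i j => by
    refine eLpNorm_two_le_of_integral_sq_le ((h n).memLp_grad i j) ?_
    have h2 := Finset.single_le_sum (f := fun j => ∫ x, g n i j x ^ 2) (fun j _ => hsq (g n i j))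
      (Finset.mem_univ j)
    have h3 := Finset.single_le_sum (f := fun i => ∑ j, ∫ x, g n i j x ^ 2)
      (fun i _ => Finset.sum_nonneg fun j _ => hsq (g n i j)) (Finset.mem_univ i)
    have h4 := hR' n
    rw [hCc]; nlinarith
  obtain ⟨σ, hσ, U, hU⟩ := exists_common_subseq_weaklyTendsto
    (v := fun (a : Fin d ⊕ Fin d × Fin d) n => Sum.elim (v n) (fun p => g n p.1 p.2) a)
    (by rintro (i | ⟨i, j⟩) n; exacts [(h n).memLp i, (h n).memLp_grad i j]) (C := C)
    (by rintro (i | ⟨i, j⟩) n; exacts [hvC n i, hgC n i j])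
  set u : Fin d → E d → ℝ := fun i => U (Sum.inl i) with hu_def
  set q : Fin d → Fin d → E d → ℝ := fun i j => U (Sum.inr (i, j)) with hq_def
  have hu : ∀ i, MemLp (u i) 2 volume := fun i => (hU (Sum.inl i)).1
  have huw : ∀ i, WeaklyTendsto (fun n => v (σ n) i) (u i) := fun i => (hU (Sum.inl i)).2
  have hq : ∀ i j, MemLp (q i j) 2 volume := fun i j => (hU (Sum.inr (i, j))).1
  have hqw : ∀ i j, WeaklyTendsto (fun n => g (σ n) i j) (q i j) :=
    fun i j => (hU (Sum.inr (i, j))).2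
  have huq : ∀ i j, IsWeakPartial j (u i) (q i j) := fun i j =>
    isWeakPartial_of_weaklyTendsto (huw i) (hqw i j) fun n => (h (σ n)).weakPartial i j
  have hv0 : ∀ n i, ∀ᵐ x ∂volume, x ∉ D → v n i x = 0 := fun n i => by
    filter_upwards [(h n).ae_eq_zero i] with x hx hxD
    exact hx fun hxΩ => hxD ((hΩ n).2.1 hxΩ)
  have hu0 : ∀ i, ∀ᵐ x ∂volume, x ∉ D → u i x = 0 := fun i =>
    (huw i).ae_eq_zero (hu i) hD.isClosed.isOpen_compl.measurableSet fun n => hv0 (σ n) i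
  have hstrong : ∀ i, Tendsto (fun n => eLpNorm (fun x => v (σ n) i x - u i x) 2 volume) atTop
      (𝓝 0) := fun i =>
    tendsto_eLpNorm_sub_of_weaklyTendsto hD (fun n => (h (σ n)).memLp i)
      (g := fun n => g (σ n) i) (fun n j => (h (σ n)).memLp_grad i j)
      (fun n j => (h (σ n)).weakPartial i j) (hu i) (hq i) (huq i) (fun n => hv0 (σ n) i) (hu0 i)
      (fun n => hvC (σ n) i) (fun n j => hgC (σ n) i j) (huw i)
  have hu1 : ∑ i, ∫ x, u i x ^ 2 = 1 := by
    have h2 : Tendsto (fun n => ∑ i, ∫ x, v (σ n) i x ^ 2) atTop (𝓝 (∑ i, ∫ x, u i x ^ 2)) :=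
      tendsto_finsetSum _ fun i _ =>
        tendsto_integral_sq (fun n => (h (σ n)).memLp i) (hu i) (huw i) (hstrong i)
    simp only [h1] at h2
    exact tendsto_nhds_unique h2 tendsto_const_nhds
  have hqm : ∑ i, ∑ j, ∫ x, q i j x ^ 2 ≤ m := by
    have h2 := sum_integral_sq_le_of_weaklyTendsto (κ := Fin d × Fin d)
      (v := fun a n => g (σ n) a.1 a.2) (u := fun a => q a.1 a.2)
      (fun a n => (h (σ n)).memLp_grad a.1 a.2) (fun a => hq a.1 a.2) (fun a => hqw a.1 a.2)
      (m := m) (by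
        refine (hm.comp hσ.tendsto_atTop).congr fun n => ?_
        simp [Fintype.sum_prod_type])
    simpa [Fintype.sum_prod_type] using h2
  have hdiv : ∀ᵐ x ∂volume, ∑ i, q i i x = 0 := by
    have hw : WeaklyTendsto (fun n x => ∑ i, g (σ n) i i x) fun x => ∑ i, q i i x := by
      intro f hf
      have h2 : Tendsto (fun n => ∑ i, ∫ x, g (σ n) i i x * f x) atTop
          (𝓝 (∑ i, ∫ x, q i i x * f x)) := tendsto_finsetSum _ fun i _ => hqw i i f hf
      simp only [Finset.sum_mul]
      rw [integral_finsetSum _ fun i _ => integrable_mul_of_memLp_two (hq i i) hf]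
      refine h2.congr fun n => ?_
      rw [integral_finsetSum _ fun i _ =>
        integrable_mul_of_memLp_two ((h (σ n)).memLp_grad i i) hf]
    have h2 := hw.ae_eq_zero (memLp_finsetSum _ fun i _ => hq i i) MeasurableSet.univ fun n => by
      filter_upwards [(h (σ n)).div_eq_zero] with x hx _
      exact hx
    simpa using h2
  -- The optimal set is built from the limit field alone; the sets Ω n only enter through the bound
  -- on its volume.
  obtain ⟨Ωs, hqo, hsubD, hW, hiff⟩ := exists_isQuasiOpen_support hD
    (fun i => ⟨hu i, fun j => ⟨q i j, hq i j, huq i j⟩⟩) hu0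
  have hsol : IsSolenoidal Ωs u q := ⟨hu, hq, huq, fun i => (hW i).ae_eq_zero, hdiv⟩
  have hvol : volume Ωs ≤ ENNReal.ofReal V₀ := by
    rw [measure_congr (t := {x | ∃ i, u i x ≠ 0}) (eventuallyEq_set.2 hiff)]
    exact volume_support_le (fun n => (hΩ (σ n)).2.2) (fun n => (h (σ n)).memLp) hu
      (fun n => (h (σ n)).ae_eq_zero) hstrong
  refine ⟨Ωs, ⟨hqo, hsubD, hvol⟩, fun x => WithLp.toLp 2 fun i => u i x,
    fun x => Matrix.of fun i j => q i j x, ⟨hW, fun i j => ⟨hq i j, huq i j⟩, ?_, ?_⟩, ?_⟩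
  · exact ae_restrict_of_ae hdiv
  · intro hae
    have h0 : ∑ i, ∫ x, u i x ^ 2 = 0 := Finset.sum_eq_zero fun i _ => by
      refine integral_eq_zero_of_ae ?_
      filter_upwards [hae] with x hx
      have := congrArg (fun y : E d => y i) hx
      simp only [Pi.zero_apply, PiLp.zero_apply] at this
      simp [this]
    rw [h0] at hu1
    exact zero_ne_one hu1
  · rw [hsol.rayleigh_eq, hu1, div_one]
    exact hqm

theorem IsStokesTest.volume_pos {Ω : Set (E d)} {u : E d → E d}
    {G : E d → Matrix (Fin d) (Fin d) ℝ} (h : IsStokesTest Ω u G) : 0 < volume Ω := by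
  rw [pos_iff_ne_zero]
  intro h0
  refine h.ne_zero ?_
  have h1 : ∀ᵐ x ∂volume, x ∉ Ω := measure_eq_zero_iff_ae_notMem.1 h0
  filter_upwards [h1, ae_all_iff.2 fun i => (h.mem i).ae_eq_zero] with x hx hxu
  ext i
  simpa using hxu i hx

theorem rayleigh_nonneg (Ω : Set (E d)) (u : E d → E d) (G : E d → Matrix (Fin d) (Fin d) ℝ) :
    0 ≤ rayleigh Ω u G :=
  div_nonneg (integral_nonneg fun _ => Finset.sum_nonneg fun _ _ => Finset.sum_nonneg fun _ _ =>
    sq_nonneg _) (integral_nonneg fun _ => sq_nonneg _)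

end

end StokesBox

theorem propositionB1 (d : ℕ) (hd : 2 ≤ d) (D : Set (StokesBox.E d)) (hD : IsCompact D)
    (hD_int : (interior D).Nonempty) (V₀ : ℝ) (hV₀ : 0 < V₀) :
    ∃ Ωs ∈ StokesBox.admissibleClass D V₀,
      (∀ Ω ∈ StokesBox.admissibleClass D V₀,
        StokesBox.lambdaOne Ωs ≤ StokesBox.lambdaOne Ω) ∧
      0 < volume Ωs ∧
      ∃ (u : StokesBox.E d → StokesBox.E d)
        (G : StokesBox.E d → Matrix (Fin d) (Fin d) ℝ),
        StokesBox.IsStokesTest Ωs u G ∧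
          StokesBox.lambdaOne Ωs = (StokesBox.rayleigh Ωs u G : EReal) := by
  -- The two nested infima, over sets and over fields, are merged into one infimum of real numbers.
  let S : Set ℝ := {r | ∃ Ω ∈ StokesBox.admissibleClass D V₀, ∃ u G,
    StokesBox.IsStokesTest Ω u G ∧ StokesBox.rayleigh Ω u G = r}
  have hSne : S.Nonempty := by
    obtain ⟨B, hB, hBo, hBne⟩ := StokesBox.exists_isOpen_mem_admissibleClass hd hD_int hV₀
    obtain ⟨u, G, h⟩ := StokesBox.exists_isStokesTest_of_isOpen hd hBo hBne
    exact ⟨_, B, hB, u, G, h, rfl⟩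
  have hSb : BddBelow S := ⟨0, by
    rintro r ⟨Ω, -, u, G, -, rfl⟩
    exact StokesBox.rayleigh_nonneg Ω u G⟩
  obtain ⟨r, -, hr, hrS⟩ := exists_seq_tendsto_sInf hSne hSb
  choose Ω hΩ u G hT hray using hrS
  choose v g hs h1 hg using fun n => (hT n).exists_normalized (hΩ n).1
  obtain ⟨Ωs, hΩs, us, Gs, hTs, hle⟩ := StokesBox.exists_isStokesTest_le hD hΩ hs h1
    (m := sInf S) (by simpa only [hg, hray] using hr)
  -- Sets without test fields are included: their infimum is empty, hence `⊤`.
  have hmin : ∀ Ω ∈ StokesBox.admissibleClass D V₀,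
      (StokesBox.rayleigh Ωs us Gs : EReal) ≤ StokesBox.lambdaOne Ω := fun Ω hΩ =>
    le_iInf fun u => le_iInf fun G => le_iInf fun hT =>
      EReal.coe_le_coe_iff.2 (hle.trans (csInf_le hSb ⟨Ω, hΩ, u, G, hT, rfl⟩))
  have heq : StokesBox.lambdaOne Ωs = (StokesBox.rayleigh Ωs us Gs : EReal) :=
    le_antisymm (iInf_le_of_le us (iInf_le_of_le Gs (iInf_le_of_le hTs le_rfl))) (hmin Ωs hΩs)
  exact ⟨Ωs, hΩs, fun Ω hΩ => heq.le.trans (hmin Ω hΩ), hTs.volume_pos, us, Gs, hTs, heq⟩
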